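/- For $a\ge 0$ let $\ell_a$ be the largest integer strictly less than $a$ if $a>0$, and $\ell_0=0$. For an interval $J\subset\mathbb R$, $\Sigma(a,L,M,J)$ is the set of functions $f$ with $|f|\le M$ on $J$, $f\in C^{\ell_a}(J)$ if $a>0$ (no continuity is required if $a=0$), and $|f^{(\ell_a)}(x)-f^{(\ell_a)}(x')|\le L|x-x'|^{a-\ell_a}$ for all $x,x'\in J$ with $|x-x'|\le 1$ (for $a=0$ this reads $|f(x)-f(x')|\le L$). Let $\alpha\ge 1$, $0\le\beta<\alpha$, $p\ge 1$, $L,M>0$, let $I\subset\mathbb R$ be an interval, of length $|I|\in(0,\infty]$ with $M|I|>1$, and let $I_0\subset I$ be a bounded non-degenerate interval. For $\varepsilon>0$ and $m\in\mathbb N$ let $H^m_{\alpha,\beta}(\varepsilon)$ be the set of probability densities $f$ supported on $I$ such that $f\in\Sigma(\beta,L,M,I)$ and there are points $x_1<\dots<x_m$ in the interior of $I$ such that $f\in\Sigma(\alpha,L,M,J)$ for each of the $m+1$ intervals $J=I\cap(-\infty,x_1-\varepsilon]$, $J=I\cap[x_i+\varepsilon,x_{i+1}-\varepsilon]$ $(1\le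 i<m)$ and $J=I\cap[x_m+\varepsilon,\infty)$ ($J=I$ if $m=0$); empty intervals impose no condition. Let $H_{\alpha,\beta}(\varepsilon)=\bigcup_{m\ge 0}H^m_{\alpha,\beta}(\varepsilon)$. Then there is a constant $c>0$, depending only on $(p,L,M,\alpha,\beta,I,I_0)$ and in particular not on $\varepsilon$, $n$ or $m$, such that for all $\varepsilon>0$ and all integers $n\ge 1$ $$\inf_{\hat f}\ \sup_{f\in H_{\alpha,\beta}(\varepsilon)}\mathbb E\big[\|\hat f-f\|_{p,I_0}^p\big]\ \ge\ c\left(n^{-\frac{p\beta+1}{2\beta+1}}\vee n^{-\frac{p\alpha}{2\alpha+1}}\right),$$ where $\|u\|_{p,I_0}^p=\int_{I_0}|u(x)|^p\,dx$, the infimum is over all (jointly measurable) estimators $\hat f$ computed from $n$ i.i.d. observations with density $f$. Moreover, if $\varepsilon\ge n^{-1/(2\beta+1)}$, then for every $m\ge 1$ the same bound, with the same $c$, holds with $H_{\alpha,\beta}(\varepsilon)$ replaced by $H^m_{\alpha,\beta}(\varepsilon)$ (so already with a single break point). -/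

import Mathlib

open MeasureTheory Set
open scoped ENNReal

noncomputable section

/-- The integer *strictly* less than `a` (for `a > 0`): the number of derivatives in the Hölder
condition of order `a`. For `a = 0` the value is `0`. -/
def holderOrder (a : ℝ) : ℕ := ⌈a⌉₊ - 1

/-- The Hölder ball `Σ(a, L, M, J)` for an interval `J`: `f` is of class `C^ℓ` on `J`, with
`ℓ = holderOrder a`, is bounded by `M` on `J`, and its `ℓ`-th derivative is `(a - ℓ)`-Hölder with
constant `L` at distances at most `1`. For `a = 0` there is no continuity requirement: the function
is bounded by `M` and its oscillation at distances at most `1` is at most `L`. -/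
structure IsHolder (a L M : ℝ) (J : Set ℝ) (f : ℝ → ℝ) : Prop where
  contDiffOn : 0 < a → ContDiffOn ℝ (holderOrder a : ℕ) f J
  bound : ∀ x ∈ J, |f x| ≤ M
  holder : ∀ x ∈ J, ∀ y ∈ J, |x - y| ≤ 1 →
    |iteratedDerivWithin (holderOrder a) f J x - iteratedDerivWithin (holderOrder a) f J y| ≤
      L * |x - y| ^ (a - (holderOrder a : ℝ))

/-- For `x₀ < ⋯ < x_{m-1}` in `I`, the `i`-th of the `m + 1` intervals that remain of `I` at
distance at least `ε` of the break points: `[x_{i-1} + ε, x_i - ε]` for `0 < i < m`, the part of `I`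
to the left of `x₀ - ε` for `i = 0`, and to the right of `x_{m-1} + ε` for `i = m`
(an interval is empty if its ends are in the wrong order). -/
def piece (I : Set ℝ) (ε : ℝ) {m : ℕ} (x : Fin m → ℝ) (i : Fin (m + 1)) : Set ℝ :=
  {y ∈ I | ∀ j : Fin m, (j.castSucc < i → x j + ε ≤ y) ∧ (i ≤ j.castSucc → y ≤ x j - ε)}

/-- `Σ_pw^ε(a, L, M, I)` with exactly `m` break points. -/
def IsPwHolder (m : ℕ) (a L M ε : ℝ) (I : Set ℝ) (f : ℝ → ℝ) : Prop :=
  ∃ x : Fin m → ℝ, StrictMono x ∧ (∀ j, x j ∈ interior I) ∧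
    ∀ i : Fin (m + 1), IsHolder a L M (piece I ε x i) f

/-- `f` is a probability density with respect to Lebesgue measure, supported on `I`. -/
structure IsDensityOn (I : Set ℝ) (f : ℝ → ℝ) : Prop where
  measurable : Measurable f
  nonneg : ∀ x, 0 ≤ f x
  supported : ∀ x, x ∉ I → f x = 0
  lintegral_eq_one : ∫⁻ x, ENNReal.ofReal (f x) = 1

/-- The densities of `H_{α,β}(ε)` with exactly `m` break points. -/
def densityClassOfCard (m : ℕ) (α β L M ε : ℝ) (I : Set ℝ) : Set (ℝ → ℝ) :=
  {f | IsDensityOn I f ∧ IsHolder β L M I f ∧ IsPwHolder m α L M ε I f}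

/-- The class `H_{α,β}(ε)`: any finite number of break points is allowed. -/
def densityClass (α β L M ε : ℝ) (I : Set ℝ) : Set (ℝ → ℝ) :=
  {f | IsDensityOn I f ∧ IsHolder β L M I f ∧ ∃ m : ℕ, IsPwHolder m α L M ε I f}

/-- The probability measure on `ℝ` with density `f`. -/
def densityLaw (f : ℝ → ℝ) : Measure ℝ :=
  volume.withDensity fun x => ENNReal.ofReal (f x)

/-- The risk `E ‖f̂ - f‖_{p,I₀}^p` of an estimator `fhat` that is computed from `n` independent
observations with density `f`. -/
def lpRisk (p : ℝ) (I₀ : Set ℝ) (n : ℕ) (fhat : (Fin n → ℝ) → ℝ → ℝ) (f : ℝ → ℝ) : ℝ≥0∞ :=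
  ∫⁻ X, (∫⁻ x in I₀, ENNReal.ofReal (|fhat X x - f x| ^ p)) ∂(Measure.pi fun _ : Fin n => densityLaw f)

/-- The minimax risk over a class `H` of densities: the infimum over all (jointly measurable)
estimators of the largest risk over `H`. -/
def minimaxRisk (p : ℝ) (I₀ : Set ℝ) (n : ℕ) (H : Set (ℝ → ℝ)) : ℝ≥0∞ :=
  ⨅ (fhat : (Fin n → ℝ) → ℝ → ℝ) (_ : Measurable (Function.uncurry fhat)),
    ⨆ f ∈ H, lpRisk p I₀ n fhat f

/-- The rate `n^{-(pβ+1)/(2β+1)} ∨ n^{-pα/(2α+1)}`. -/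
def lowerRate (p α β : ℝ) (n : ℕ) : ℝ :=
  max ((n : ℝ) ^ (-((p * β + 1) / (2 * β + 1)))) ((n : ℝ) ^ (-(p * α / (2 * α + 1))))

end

/-! The bound comes from perturbing a baseline density by waves that `n` observations cannot detect.
Since `M|I| > 1`, some density on `I` has maximum `κ < M`, is constant on an interval `[u, v]`
inside `I₀`, and has derivatives as small as desired (`exists_isBaseline`). Odd bumps of width `h`
and amplitude `A₀ h ^ a` have integral zero and Hölder norm of order `a` bounded uniformly in `h`
(`holderIncrement_waves`). If `n h ^ (2a + 1) ≤ 1`, adding one wave changes the `n`-fold law only by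
a bounded chi-square amount, so no estimator can tell whether it is present (`two_point_bound`).
`assouad` then charges every wave a loss of order `h ^ (ap + 1)`.

With `a = α` and about `1 / h` disjoint waves filling `[u, v]`, the losses add up to `h ^ (αp)`, the
smooth rate. The break points play no role here.

With `a = β` a single wave gives `h ^ (βp + 1)`, the rough rate. Such a wave is too steep for order
`α`, but no smoothness of order `α` is asked within `ε` of a break point, so it suffices to cover
its support by such neighbourhoods. If `ε ≥ n ^ (-1/(2β+1)) ≥ h`, one break point at the centre does
this. For smaller `ε`, an unrestricted number of break points allows a grid of mesh below `ε` on
`[u, v]` (`exists_strictMono_fine`); hence the constant does not depend on `ε`. -/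

/-! ### Product laws and Le Cam's two point method -/

/-- **Tonelli's theorem** for a product of functions of the single coordinates. -/
lemma lintegral_pi_prod {n : ℕ} (μ : Measure ℝ) [IsProbabilityMeasure μ]
    {r : Fin n → ℝ → ℝ≥0∞} (hr : ∀ i, Measurable (r i)) :
    ∫⁻ X : Fin n → ℝ, ∏ i, r i (X i) ∂(Measure.pi fun _ => μ) = ∏ i, ∫⁻ x, r i x ∂μ := by
  have hind : ProbabilityTheory.iIndepFun (fun (i : Fin n) (X : Fin n → ℝ) => r i (X i))
      (Measure.pi fun _ => μ) :=
    ProbabilityTheory.iIndepFun_pi (X := r) (μ := fun _ => μ)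
      fun i => (hr i).aemeasurable
  rw [ProbabilityTheory.lintegral_prod_eq_prod_lintegral_of_indepFun Finset.univ _ hind
    fun i => (hr i).comp (measurable_pi_apply i)]
  refine Finset.prod_congr rfl fun i _ => ?_
  rw [← (measurePreserving_eval (fun _ : Fin n => μ) i).lintegral_comp (hr i)]

lemma lintegral_pi_prod_eq_pow {n : ℕ} (μ : Measure ℝ) [IsProbabilityMeasure μ]
    {r : ℝ → ℝ≥0∞} (hr : Measurable r) :
    ∫⁻ X : Fin n → ℝ, ∏ i, r (X i) ∂(Measure.pi fun _ => μ) = (∫⁻ x, r x ∂μ) ^ n := by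
  rw [lintegral_pi_prod μ fun _ => hr]; simp

/-- The product of measures with density has the product density. -/
lemma pi_withDensity {n : ℕ} (μ : Measure ℝ) [IsProbabilityMeasure μ]
    {r : ℝ → ℝ≥0∞} (hr : Measurable r) [IsProbabilityMeasure (μ.withDensity r)] :
    (Measure.pi fun _ : Fin n => μ.withDensity r) =
      (Measure.pi fun _ : Fin n => μ).withDensity fun X => ∏ i, r (X i) := by
  refine Measure.pi_eq fun s hs => ?_
  rw [withDensity_apply _ (MeasurableSet.univ_pi hs),
    ← lintegral_indicator (MeasurableSet.univ_pi hs)]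
  have : ∀ X : Fin n → ℝ, (univ.pi s).indicator (fun X => ∏ i, r (X i)) X =
      ∏ i, (s i).indicator r (X i) := by
    intro X
    by_cases hX : X ∈ univ.pi s
    · rw [indicator_of_mem hX]
      exact Finset.prod_congr rfl fun i _ => (indicator_of_mem (hX i trivial) _).symm
    · rw [indicator_of_notMem hX]
      simp only [mem_univ_pi, not_forall] at hX
      obtain ⟨i, hi⟩ := hX
      exact (Finset.prod_eq_zero (Finset.mem_univ i) (indicator_of_notMem hi _)).symm
  simp_rw [this]
  rw [lintegral_pi_prod μ fun i => hr.indicator (hs i)]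
  refine Finset.prod_congr rfl fun i _ => ?_
  rw [lintegral_indicator (hs i), withDensity_apply _ (hs i)]

/-- For `R ≥ 1` this is `(R - 2)² ≥ 0`. Integrated against a law under which `R` has mean 1 and
second moment at most 2, it gives an affinity of at least `1 - 2/4`. -/
lemma ENNReal.le_min_one_add_sq_div_four (R : ℝ≥0∞) : R ≤ min 1 R + R ^ 2 / 4 := by
  rcases eq_or_ne R ∞ with rfl | hR
  · simp [ENNReal.top_div]
  lift R to NNReal using hR
  rcases le_total R 1 with h | h
  · rw [min_eq_right (by exact_mod_cast h)]
    exact le_self_add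
  · rw [min_eq_left (by exact_mod_cast h)]
    have : R ≤ 1 + R ^ 2 / 4 := by
      rw [← NNReal.coe_le_coe]
      push_cast
      nlinarith [sq_nonneg ((R : ℝ) - 2)]
    have h4 : ((R : ℝ≥0∞) ^ 2 / 4) = ((R ^ 2 / 4 : NNReal) : ℝ≥0∞) := by
      rw [ENNReal.coe_div (by norm_num)]; norm_num
    rw [h4]
    exact_mod_cast this

/-- If the likelihood ratio `r` has second moment at most `2 ^ (1 / n)`, then the affinity of the
`n`-fold products is at least `1 / 2`. -/
lemma half_le_affinity {n : ℕ} (μ : Measure ℝ) [IsProbabilityMeasure μ]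
    {r : ℝ → ℝ≥0∞} (hr : Measurable r) (h1 : ∫⁻ x, r x ∂μ = 1)
    (h2 : (∫⁻ x, r x ^ 2 ∂μ) ^ n ≤ 2) :
    1 / 2 ≤ ∫⁻ X : Fin n → ℝ, min 1 (∏ i, r (X i)) ∂(Measure.pi fun _ => μ) := by
  have hR : Measurable fun X : Fin n → ℝ => ∏ i, r (X i) :=
    Finset.measurable_prod _ fun i _ => hr.comp (measurable_pi_apply i)
  have e1 : ∫⁻ X : Fin n → ℝ, ∏ i, r (X i) ∂(Measure.pi fun _ => μ) = 1 := by
    rw [lintegral_pi_prod_eq_pow μ hr, h1, one_pow]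
  have e2 : ∫⁻ X : Fin n → ℝ, (∏ i, r (X i)) ^ 2 ∂(Measure.pi fun _ => μ) ≤ 2 := by
    simp_rw [← Finset.prod_pow]
    rwa [lintegral_pi_prod_eq_pow μ (hr.pow_const 2)]
  have e3 : (1 : ℝ≥0∞) ≤ (∫⁻ X : Fin n → ℝ, min 1 (∏ i, r (X i)) ∂(Measure.pi fun _ => μ))
      + 1 / 2 := by
    calc (1 : ℝ≥0∞) = ∫⁻ X : Fin n → ℝ, ∏ i, r (X i) ∂(Measure.pi fun _ => μ) := e1.symm
      _ ≤ ∫⁻ X : Fin n → ℝ, (min 1 (∏ i, r (X i)) + (∏ i, r (X i)) ^ 2 / 4)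
            ∂(Measure.pi fun _ => μ) :=
          lintegral_mono fun X => ENNReal.le_min_one_add_sq_div_four _
      _ = (∫⁻ X : Fin n → ℝ, min 1 (∏ i, r (X i)) ∂(Measure.pi fun _ => μ)) +
            (∫⁻ X : Fin n → ℝ, (∏ i, r (X i)) ^ 2 ∂(Measure.pi fun _ => μ)) / 4 := by
          rw [lintegral_add_left (measurable_const.min hR)]
          simp_rw [div_eq_mul_inv]
          rw [lintegral_mul_const _ (hR.pow_const 2)]
      _ ≤ _ := by
          refine add_le_add le_rfl ?_
          calc _ ≤ (2 : ℝ≥0∞) / 4 := ENNReal.div_le_div_right e2 4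
            _ = 1 / 2 := by
              rw [show (4 : ℝ≥0∞) = 2 * 2 by norm_num, ENNReal.div_eq_div_iff] <;> norm_num
  have : (1 : ℝ≥0∞) = 1 / 2 + 1 / 2 := (ENNReal.add_halves 1).symm
  exact (ENNReal.add_le_add_iff_right (a := 1 / 2) (by simp)).1 (this ▸ e3)

/-- **Le Cam's two point bound**, in terms of the likelihood ratio `r`. -/
lemma two_point_bound {n : ℕ} (μ : Measure ℝ) [IsProbabilityMeasure μ]
    {r : ℝ → ℝ≥0∞} (hr : Measurable r) (h1 : ∫⁻ x, r x ∂μ = 1)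
    (h2 : (∫⁻ x, r x ^ 2 ∂μ) ^ n ≤ 2) {a b : (Fin n → ℝ) → ℝ≥0∞} (ha : Measurable a)
    (hb : Measurable b)
    {s : ℝ≥0∞} (hs : ∀ X, s ≤ a X + b X) :
    s / 2 ≤ (∫⁻ X, a X ∂(Measure.pi fun _ => μ)) +
      ∫⁻ X, b X ∂(Measure.pi fun _ => μ.withDensity r) := by
  have hR : Measurable fun X : Fin n → ℝ => ∏ i, r (X i) :=
    Finset.measurable_prod _ fun i _ => hr.comp (measurable_pi_apply i)
  have : IsProbabilityMeasure (μ.withDensity r) := ⟨by simp [h1]⟩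
  rw [pi_withDensity μ hr]
  calc s / 2 = s * (1 / 2) := by rw [mul_one_div]
    _ ≤ s * ∫⁻ X : Fin n → ℝ, min 1 (∏ i, r (X i)) ∂(Measure.pi fun _ => μ) := by
        gcongr; exact half_le_affinity μ hr h1 h2
    _ = ∫⁻ X : Fin n → ℝ, s * min 1 (∏ i, r (X i)) ∂(Measure.pi fun _ => μ) := by
        rw [lintegral_const_mul _ (measurable_const.min hR)]
    _ ≤ ∫⁻ X : Fin n → ℝ, (a X + (∏ i, r (X i)) * b X) ∂(Measure.pi fun _ => μ) := by
        refine lintegral_mono fun X => ?_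
        calc s * min 1 (∏ i, r (X i)) ≤ (a X + b X) * min 1 (∏ i, r (X i)) := by
              gcongr; exact hs X
          _ = a X * min 1 (∏ i, r (X i)) + b X * min 1 (∏ i, r (X i)) := add_mul _ _ _
          _ ≤ a X * 1 + b X * (∏ i, r (X i)) := by
              gcongr
              · exact min_le_left _ _
              · exact min_le_right _ _
          _ = _ := by rw [mul_one, mul_comm (b X)]
    _ = (∫⁻ X, a X ∂(Measure.pi fun _ => μ)) +
          ∫⁻ X, (∏ i, r (X i)) * b X ∂(Measure.pi fun _ => μ) := lintegral_add_left ha _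
    _ = _ := by
        rw [lintegral_withDensity_eq_lintegral_mul _ hR hb]
        rfl

/-- The power is at most `exp (1/2)`, and `e < 4`. Thus a chi-square distance of `1/(2n)` per
observation is affordable. -/
lemma one_add_inv_two_mul_pow_le_two (n : ℕ) (hn : 1 ≤ n) : (1 + 1 / (2 * (n : ℝ))) ^ n ≤ 2 := by
  have hn' : (0 : ℝ) < n := by exact_mod_cast hn
  have h1 : (1 + 1 / (2 * (n : ℝ))) ^ n ≤ Real.exp (1 / (2 * (n : ℝ))) ^ n := by
    gcongr
    rw [add_comm]
    exact Real.add_one_le_exp _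
  rw [← Real.exp_nat_mul, show (n : ℝ) * (1 / (2 * (n : ℝ))) = 1 / 2 by field_simp] at h1
  refine h1.trans ?_
  have h2 : Real.exp (1 / 2) ^ 2 = Real.exp 1 := by
    rw [← Real.exp_nat_mul]; norm_num
  nlinarith [Real.exp_one_lt_d9, Real.exp_pos (1 / 2)]

lemma isProbabilityMeasure_densityLaw {f : ℝ → ℝ} (h : ∫⁻ x, ENNReal.ofReal (f x) = 1) :
    IsProbabilityMeasure (densityLaw f) := ⟨by simp [densityLaw, h]⟩

lemma measurable_localLoss {n : ℕ} {fhat : (Fin n → ℝ) → ℝ → ℝ}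
    (hfhat : Measurable (Function.uncurry fhat)) {f : ℝ → ℝ} (hf : Measurable f) (p : ℝ)
    (B : Set ℝ) :
    Measurable fun X => ∫⁻ x in B, ENNReal.ofReal (|fhat X x - f x| ^ p) := by
  have : Measurable (Function.uncurry fun (X : Fin n → ℝ) (x : ℝ) =>
      ENNReal.ofReal (|fhat X x - f x| ^ p)) := by
    have h1 : Measurable fun q : (Fin n → ℝ) × ℝ => fhat q.1 q.2 - f q.2 :=
      hfhat.sub (hf.comp measurable_snd)
    exact ((continuous_abs.measurable.comp h1).pow_const p).ennreal_ofReal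
  exact this.lintegral_prod_right

/-- Two densities that differ only on `B`, by at most `D`: neither can be estimated on `B` with a
risk much smaller than the `L^p` distance of the two. -/
lemma lintegral_dist_le_lpRisk_add_lpRisk {n : ℕ} (hn : 1 ≤ n) {p : ℝ} (hp : 1 ≤ p)
    {f g : ℝ → ℝ} (hf : Measurable f) (hg : Measurable g) (hf0 : ∀ x, 0 ≤ f x)
    (hg0 : ∀ x, 0 ≤ g x) (hf1 : ∫⁻ x, ENNReal.ofReal (f x) = 1)
    (hg1 : ∫⁻ x, ENNReal.ofReal (g x) = 1) {B : Set ℝ} (hB : MeasurableSet B)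
    {κ D w : ℝ} (hκ : 0 < κ) (hfB : ∀ x ∈ B, κ ≤ f x) (hfg : ∀ x, x ∉ B → g x = f x)
    (hD : ∀ x ∈ B, |g x - f x| ≤ D) (hw : volume B ≤ ENNReal.ofReal w)
    (hχ : D ^ 2 / κ * w ≤ 1 / (2 * n))
    {fhat : (Fin n → ℝ) → ℝ → ℝ} (hfhat : Measurable (Function.uncurry fhat)) :
    ∫⁻ x in B, ENNReal.ofReal (|g x - f x| ^ p) ≤
      ENNReal.ofReal (2 ^ p) * (lpRisk p B n fhat f + lpRisk p B n fhat g) := by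
  classical
  have hp0 : 0 ≤ p := by linarith
  have := isProbabilityMeasure_densityLaw hf1
  -- Setting `r = 1` off `B`, where `f` may vanish, keeps `f r = g` true everywhere.
  set r : ℝ → ℝ≥0∞ := fun x => if x ∈ B then ENNReal.ofReal (g x / f x) else 1 with hr_def
  have hr : Measurable r := Measurable.ite hB (hg.div hf).ennreal_ofReal measurable_const
  have hfr : ∀ x, ENNReal.ofReal (f x) * r x = ENNReal.ofReal (g x) := by
    intro x
    by_cases hx : x ∈ B
    · have : 0 < f x := hκ.trans_le (hfB x hx)
      simp only [hr_def, if_pos hx]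
      rw [← ENNReal.ofReal_mul (hf0 x), mul_div_cancel₀ _ this.ne']
    · simp [hr_def, hx, hfg x hx]
  have hlaw : densityLaw g = (densityLaw f).withDensity r := by
    rw [densityLaw, densityLaw, ← withDensity_mul _ hf.ennreal_ofReal hr]
    congr 1
    funext x
    exact (hfr x).symm
  have h1 : ∫⁻ x, r x ∂(densityLaw f) = 1 := by
    rw [densityLaw, lintegral_withDensity_eq_lintegral_mul _ hf.ennreal_ofReal hr, ← hg1]
    exact lintegral_congr hfr
  have h2 : ∫⁻ x, r x ^ 2 ∂(densityLaw f) ≤ ENNReal.ofReal (1 + 1 / (2 * n)) := by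
    rw [densityLaw, lintegral_withDensity_eq_lintegral_mul _ hf.ennreal_ofReal (hr.pow_const 2)]
    -- The identity `f r² + f = 2 g + (g - f)² / f`, kept in additive form to avoid truncated
    -- subtraction. As `f` and `g` have mass 1, only the chi-square term exceeds 1.
    have hpt : ∀ x, ENNReal.ofReal (f x) * r x ^ 2 + ENNReal.ofReal (f x) ≤
        2 * ENNReal.ofReal (g x) + B.indicator (fun _ => ENNReal.ofReal (D ^ 2 / κ)) x := by
      intro x
      by_cases hx : x ∈ B
      · have hfx : 0 < f x := hκ.trans_le (hfB x hx)
        simp only [hr_def, if_pos hx, indicator_of_mem hx]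
        rw [← ENNReal.ofReal_pow (div_nonneg (hg0 x) (hf0 x)), ← ENNReal.ofReal_mul (hf0 x),
          ← ENNReal.ofReal_add (by positivity) (hf0 x),
          show (2 : ℝ≥0∞) = ENNReal.ofReal 2 by simp, ← ENNReal.ofReal_mul (by norm_num),
          ← ENNReal.ofReal_add (mul_nonneg (by norm_num) (hg0 x)) (by positivity)]
        refine ENNReal.ofReal_le_ofReal ?_
        have e : f x * (g x / f x) ^ 2 + f x = 2 * g x + (g x - f x) ^ 2 / f x := by
          field_simp; ring
        rw [e]
        have : (g x - f x) ^ 2 / f x ≤ D ^ 2 / κ := by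
          refine div_le_div₀ (sq_nonneg _) ?_ hκ (hfB x hx)
          rw [← sq_abs]
          exact pow_le_pow_left₀ (abs_nonneg _) (hD x hx) 2
        linarith
      · simp [hr_def, hx, hfg x hx, two_mul]
    have hint := lintegral_mono hpt (μ := volume)
    rw [lintegral_add_right _ hf.ennreal_ofReal, hf1, lintegral_add_left
      (hg.ennreal_ofReal.const_mul 2), lintegral_const_mul _ hg.ennreal_ofReal, hg1,
      lintegral_indicator_const hB] at hint
    have hbd : ENNReal.ofReal (D ^ 2 / κ) * volume B ≤ ENNReal.ofReal (1 / (2 * n)) := by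
      calc _ ≤ ENNReal.ofReal (D ^ 2 / κ) * ENNReal.ofReal w := by gcongr
        _ = ENNReal.ofReal (D ^ 2 / κ * w) := (ENNReal.ofReal_mul (by positivity)).symm
        _ ≤ _ := ENNReal.ofReal_le_ofReal hχ
    rw [ENNReal.ofReal_add zero_le_one (by positivity), ENNReal.ofReal_one]
    refine (ENNReal.add_le_add_iff_right (a := 1) ENNReal.one_ne_top).1 ?_
    refine hint.trans ?_
    calc _ ≤ 2 * 1 + ENNReal.ofReal (1 / (2 * n)) := by gcongr
      _ = _ := by ring
  have h2n : (∫⁻ x, r x ^ 2 ∂(densityLaw f)) ^ n ≤ 2 := by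
    calc _ ≤ ENNReal.ofReal (1 + 1 / (2 * n)) ^ n := by gcongr
      _ = ENNReal.ofReal ((1 + 1 / (2 * n)) ^ n) := (ENNReal.ofReal_pow (by positivity) n).symm
      _ ≤ ENNReal.ofReal 2 := ENNReal.ofReal_le_ofReal (one_add_inv_two_mul_pow_le_two n hn)
      _ = 2 := by simp
  -- The convexity constant in `(a + b) ^ p ≤ 2 ^ (p - 1) (a ^ p + b ^ p)`; the factor 1/2 in the
  -- two point bound turns it into `2 ^ p`.
  set C : ℝ≥0∞ := ENNReal.ofReal (2 ^ (p - 1)) with hC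
  set s := ∫⁻ x in B, ENNReal.ofReal (|g x - f x| ^ p) with hs
  have hla := measurable_localLoss hfhat hf p B
  have hlb := measurable_localLoss hfhat hg p B
  have hsum : ∀ X, s ≤ C * (∫⁻ x in B, ENNReal.ofReal (|fhat X x - f x| ^ p)) +
      C * (∫⁻ x in B, ENNReal.ofReal (|fhat X x - g x| ^ p)) := by
    intro X
    have hX : Measurable (fhat X) := hfhat.comp measurable_prodMk_left
    have hm : Measurable fun x => ENNReal.ofReal (|fhat X x - f x| ^ p) :=
      ((continuous_abs.measurable.comp (hX.sub hf)).pow_const p).ennreal_ofReal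
    rw [← mul_add, ← lintegral_add_left hm, ← lintegral_const_mul']
    swap
    · exact ENNReal.ofReal_ne_top
    refine lintegral_mono fun x => ?_
    rw [← ENNReal.ofReal_add (by positivity) (by positivity),
      ← ENNReal.ofReal_mul (by positivity)]
    refine ENNReal.ofReal_le_ofReal ?_
    have ht : |g x - f x| ≤ |fhat X x - f x| + |fhat X x - g x| := by
      have := abs_sub_le (g x) (fhat X x) (f x)
      rw [abs_sub_comm (g x) (fhat X x)] at this
      linarith
    calc |g x - f x| ^ p ≤ (|fhat X x - f x| + |fhat X x - g x|) ^ p :=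
          Real.rpow_le_rpow (abs_nonneg _) ht hp0
      _ ≤ _ := by
          have := NNReal.rpow_add_le_mul_rpow_add_rpow (Real.nnabs (fhat X x - f x))
            (Real.nnabs (fhat X x - g x)) hp
          exact_mod_cast this
  have hmain := two_point_bound (densityLaw f) hr h1 h2n (hla.const_mul C) (hlb.const_mul C) hsum
  rw [← hlaw, lintegral_const_mul _ hla, lintegral_const_mul _ hlb, ← mul_add] at hmain
  rw [ENNReal.div_le_iff (by norm_num) (by norm_num)] at hmain
  refine hmain.trans_eq ?_
  have h22 : ENNReal.ofReal (2 ^ p) = C * 2 := by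
    rw [hC, show (2 : ℝ≥0∞) = ENNReal.ofReal 2 by simp, ← ENNReal.ofReal_mul (by positivity)]
    congr 1
    rw [← Real.rpow_add_one (by norm_num)]
    simp
  rw [h22]
  simp only [lpRisk]
  ring

/-- The risk is superadditive in the set on which the loss is measured. -/
lemma sum_lpRisk_le {n N : ℕ} {p : ℝ} {I₀ : Set ℝ} {B : Fin N → Set ℝ}
    (hB : ∀ k, MeasurableSet (B k)) (hd : Pairwise (Function.onFun Disjoint B))
    (hBI : ∀ k, B k ⊆ I₀) {fhat : (Fin n → ℝ) → ℝ → ℝ}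
    (hfhat : Measurable (Function.uncurry fhat)) {f : ℝ → ℝ} (hf : Measurable f) :
    ∑ k, lpRisk p (B k) n fhat f ≤ lpRisk p I₀ n fhat f := by
  simp only [lpRisk]
  rw [← lintegral_finsetSum _ fun k _ => measurable_localLoss hfhat hf p (B k)]
  refine lintegral_mono fun X => ?_
  have := lintegral_iUnion (μ := volume) hB hd fun x => ENNReal.ofReal (|fhat X x - f x| ^ p)
  rw [tsum_fintype] at this
  rw [← this]
  exact lintegral_mono_set (iUnion_subset hBI)

/-! ### Assouad's lemma -/

/-- **Assouad's lemma** for a family of densities indexed by the subsets of `Fin N`. -/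
lemma assouad {n N : ℕ} (hn : 1 ≤ n) {p : ℝ} (hp : 1 ≤ p) {I₀ : Set ℝ}
    {B : Fin N → Set ℝ} (hB : ∀ k, MeasurableSet (B k))
    (hd : Pairwise (Function.onFun Disjoint B)) (hBI : ∀ k, B k ⊆ I₀)
    {F : Finset (Fin N) → ℝ → ℝ} (hF : ∀ S, Measurable (F S)) (hF0 : ∀ S x, 0 ≤ F S x)
    (hF1 : ∀ S, ∫⁻ x, ENNReal.ofReal (F S x) = 1) {κ D w : ℝ} (hκ : 0 < κ)
    (hFB : ∀ S k, ∀ x ∈ B k, κ ≤ F S x)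
    (hins : ∀ S k, k ∉ S → ∀ x, x ∉ B k → F (insert k S) x = F S x)
    (hD : ∀ S k, k ∉ S → ∀ x ∈ B k, |F (insert k S) x - F S x| ≤ D)
    (hw : ∀ k, volume (B k) ≤ ENNReal.ofReal w) (hχ : D ^ 2 / κ * w ≤ 1 / (2 * n))
    {s : ℝ≥0∞} (hs : ∀ S k, k ∉ S →
      s ≤ ∫⁻ x in B k, ENNReal.ofReal (|F (insert k S) x - F S x| ^ p))
    {fhat : (Fin n → ℝ) → ℝ → ℝ} (hfhat : Measurable (Function.uncurry fhat))
    {T : ℝ≥0∞} (hT : ∀ S, lpRisk p I₀ n fhat (F S) ≤ T) :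
    N * s ≤ ENNReal.ofReal (2 ^ p) * (2 * T) := by
  set C := ENNReal.ofReal (2 ^ p)
  let ρ : Finset (Fin N) → Fin N → ℝ≥0∞ := fun S k => lpRisk p (B k) n fhat (F S)
  have hpair : ∀ S k, k ∉ S → s ≤ C * (ρ S k + ρ (insert k S) k) := fun S k hk =>
    (hs S k hk).trans (lintegral_dist_le_lpRisk_add_lpRisk hn hp (hF S) (hF _) (hF0 S) (hF0 _)
      (hF1 S) (hF1 _) (hB k) hκ (hFB S k) (hins S k hk) (hD S k hk) (hw k) hχ hfhat)
  have hflip : ∀ S k, s ≤ C * (ρ S k + ρ (symmDiff S {k}) k) := by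
    intro S k
    by_cases hk : k ∈ S
    · have e1 : symmDiff S {k} = S.erase k := by
        ext j
        by_cases hj : j = k <;> simp [Finset.mem_symmDiff, hj, hk]
      have := hpair (S.erase k) k (Finset.notMem_erase k S)
      rw [Finset.insert_erase hk, add_comm] at this
      rwa [e1]
    · have e1 : symmDiff S {k} = insert k S := by
        ext j
        by_cases hj : j = k <;> simp [Finset.mem_symmDiff, hj, hk]
      rw [e1]
      exact hpair S k hk
  have hk : ∀ k, (2 : ℝ≥0∞) ^ N * s ≤ C * (2 * ∑ S, ρ S k) := by
    intro k
    -- Toggling `k` is an involution of the subsets, so both risks of a pair have the same sum over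
    -- all `S`.
    have e : ∑ S, ρ (symmDiff S {k}) k = ∑ S, ρ S k :=
      (Function.Involutive.bijective (f := fun S : Finset (Fin N) => symmDiff S {k})
        fun S => symmDiff_symmDiff_cancel_right _ _).sum_comp fun S => ρ S k
    calc (2 : ℝ≥0∞) ^ N * s = ∑ _S : Finset (Fin N), s := by simp
      _ ≤ ∑ S : Finset (Fin N), C * (ρ S k + ρ (symmDiff S {k}) k) :=
          Finset.sum_le_sum fun S _ => hflip S k
      _ = C * (2 * ∑ S, ρ S k) := by
          rw [← Finset.mul_sum, Finset.sum_add_distrib, e, two_mul]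
  have htot : (2 : ℝ≥0∞) ^ N * (N * s) ≤ (2 : ℝ≥0∞) ^ N * (C * (2 * T)) := by
    calc (2 : ℝ≥0∞) ^ N * (N * s) = ∑ _k : Fin N, (2 : ℝ≥0∞) ^ N * s := by
          simp; ring
      _ ≤ ∑ k : Fin N, C * (2 * ∑ S, ρ S k) := Finset.sum_le_sum fun k _ => hk k
      _ = C * (2 * ∑ S, ∑ k, ρ S k) := by
          rw [← Finset.mul_sum, ← Finset.mul_sum, Finset.sum_comm]
      _ ≤ C * (2 * ∑ _S : Finset (Fin N), T) := by
          gcongr with S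
          exact (sum_lpRisk_le hB hd hBI hfhat (hF S)).trans (hT S)
      _ = (2 : ℝ≥0∞) ^ N * (C * (2 * T)) := by
          simp; ring
  exact (ENNReal.mul_le_mul_iff_right (by simp) (by simp)).1 htot

/-! ### Hölder conditions for smooth functions -/

open scoped ContDiff

lemma holderOrder_le {a : ℝ} (ha : 0 ≤ a) : (holderOrder a : ℝ) ≤ a := by
  rcases ha.eq_or_lt with rfl | h
  · simp [holderOrder]
  · have h1 : 1 ≤ ⌈a⌉₊ := Nat.one_le_ceil_iff.2 h
    have h2 := Nat.ceil_lt_add_one ha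
    rw [holderOrder, Nat.cast_sub h1]
    push_cast
    linarith

lemma le_holderOrder_add_one (a : ℝ) : a ≤ holderOrder a + 1 := by
  have h1 : ⌈a⌉₊ ≤ holderOrder a + 1 := by unfold holderOrder; omega
  exact (Nat.le_ceil a).trans (by exact_mod_cast h1)

lemma holderOrder_mono {a b : ℝ} (h : a ≤ b) : holderOrder a ≤ holderOrder b :=
  Nat.sub_le_sub_right (Nat.ceil_mono h) 1

/-- The Hölder condition of order `a` with constant `L` on the whole line, for a function that has
sufficiently many derivatives. -/
def HolderIncrement (a L : ℝ) (F : ℝ → ℝ) : Prop :=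
  ∀ x y, |x - y| ≤ 1 → |iteratedDeriv (holderOrder a) F x - iteratedDeriv (holderOrder a) F y| ≤
    L * |x - y| ^ (a - (holderOrder a : ℝ))

lemma HolderIncrement.mono {a L L' : ℝ} {F : ℝ → ℝ} (h : HolderIncrement a L F) (hL : L ≤ L') :
    HolderIncrement a L' F := fun x y hxy =>
  (h x y hxy).trans (mul_le_mul_of_nonneg_right hL (Real.rpow_nonneg (abs_nonneg _) _))

lemma HolderIncrement.add {a L L' : ℝ} {F G : ℝ → ℝ} (hF : HolderIncrement a L F)
    (hG : HolderIncrement a L' G) (hFs : ContDiff ℝ ∞ F) (hGs : ContDiff ℝ ∞ G) :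
    HolderIncrement a (L + L') (F + G) := by
  intro x y hxy
  have e : ∀ z, iteratedDeriv (holderOrder a) (F + G) z =
      iteratedDeriv (holderOrder a) F z + iteratedDeriv (holderOrder a) G z := fun z =>
    iteratedDeriv_add ((hFs.of_le (by exact_mod_cast le_top)).contDiffAt)
      ((hGs.of_le (by exact_mod_cast le_top)).contDiffAt)
  rw [e, e, add_mul]
  refine le_trans (le_of_eq ?_) ((abs_add_le _ _).trans (add_le_add (hF x y hxy) (hG x y hxy)))
  congr 1
  ring

lemma abs_iteratedDeriv_sub_le {F : ℝ → ℝ} (hF : ContDiff ℝ ∞ F) {j : ℕ} {C : ℝ}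
    (hC : ∀ x, |iteratedDeriv (j + 1) F x| ≤ C) (x y : ℝ) :
    |iteratedDeriv j F x - iteratedDeriv j F y| ≤ C * |x - y| := by
  have hd : Differentiable ℝ (iteratedDeriv j F) :=
    hF.differentiable_iteratedDeriv j (by exact_mod_cast ENat.natCast_lt_top j)
  refine Convex.norm_image_sub_le_of_norm_deriv_le (s := univ) (fun z _ => hd z)
    (fun z _ => ?_) convex_univ (mem_univ y) (mem_univ x)
  rw [← iteratedDeriv_succ]
  exact hC z

/-- The mean value inequality gives a Lipschitz bound, and `|x - y| ≤ |x - y| ^ b` for `b ≤ 1` at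
distances at most 1. -/
lemma holderIncrement_of_deriv_le {a C : ℝ} {F : ℝ → ℝ} (hF : ContDiff ℝ ∞ F)
    (hC : ∀ x, |iteratedDeriv (holderOrder a + 1) F x| ≤ C) : HolderIncrement a C F := by
  intro x y hxy
  refine (abs_iteratedDeriv_sub_le hF hC x y).trans ?_
  have hC0 : 0 ≤ C := (abs_nonneg _).trans (hC 0)
  refine mul_le_mul_of_nonneg_left ?_ hC0
  rcases eq_or_ne x y with rfl | hne
  · simpa using Real.rpow_nonneg le_rfl _
  · have hpos : 0 < |x - y| := abs_pos.2 (sub_ne_zero.2 hne)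
    calc |x - y| = |x - y| ^ (1 : ℝ) := (Real.rpow_one _).symm
      _ ≤ _ := Real.rpow_le_rpow_of_exponent_ge hpos hxy
        (by linarith [le_holderOrder_add_one a])

/-- Interpolation between the bounds of two consecutive derivatives, at scale `h`. -/
lemma holderIncrement_of_scale {a C h : ℝ} (ha : 0 ≤ a) {F : ℝ → ℝ} (hF : ContDiff ℝ ∞ F)
    (h0 : 0 < h)
    (hC : ∀ x, |iteratedDeriv (holderOrder a) F x| ≤ C * h ^ (a - holderOrder a))
    (hC' : ∀ x, |iteratedDeriv (holderOrder a + 1) F x| ≤ C * h ^ (a - holderOrder a - 1)) :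
    HolderIncrement a (2 * C) F := by
  intro x y _
  set b : ℝ := a - holderOrder a with hb
  have hb0 : 0 ≤ b := by linarith [holderOrder_le ha]
  have hb1 : b ≤ 1 := by linarith [le_holderOrder_add_one a]
  have hC0 : 0 ≤ C := by
    have := (abs_nonneg _).trans (hC 0)
    exact nonneg_of_mul_nonneg_left this (Real.rpow_pos_of_pos h0 _)
  rcases eq_or_ne x y with rfl | hne
  · simpa using mul_nonneg (mul_nonneg zero_le_two hC0) (Real.rpow_nonneg le_rfl _)
  have hpos : 0 < |x - y| := abs_pos.2 (sub_ne_zero.2 hne)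
  have hp := Real.rpow_pos_of_pos hpos b
  -- Below the scale `h` the higher derivative wins; above it, the triangle inequality suffices and
  -- produces the factor 2.
  rcases le_total (|x - y|) h with hle | hle
  · have h1 := abs_iteratedDeriv_sub_le hF hC' x y
    have h2 : h ^ (b - 1) ≤ |x - y| ^ (b - 1) :=
      Real.rpow_le_rpow_of_nonpos hpos hle (by linarith)
    have h3 : |x - y| ^ (b - 1) * |x - y| = |x - y| ^ b := by
      rw [← Real.rpow_add_one hpos.ne']; simp
    calc _ ≤ C * h ^ (b - 1) * |x - y| := h1
      _ ≤ C * |x - y| ^ (b - 1) * |x - y| := by gcongr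
      _ = C * |x - y| ^ b := by rw [mul_assoc, h3]
      _ ≤ 2 * C * |x - y| ^ b := by
          nlinarith [mul_nonneg hC0 hp.le]
  · have h2 : h ^ b ≤ |x - y| ^ b := Real.rpow_le_rpow h0.le hle hb0
    calc _ ≤ |iteratedDeriv (holderOrder a) F x| + |iteratedDeriv (holderOrder a) F y| :=
          abs_sub _ _
      _ ≤ C * h ^ b + C * h ^ b := add_le_add (hC x) (hC y)
      _ ≤ C * |x - y| ^ b + C * |x - y| ^ b := by gcongr
      _ = _ := by ring

/-- A piece may be empty or a single point, where derivatives within `J` are not unique. The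
increment matters only for two distinct points of `J`; then the convex set `J` has interior, and its
derivatives are those of `F`. -/
lemma IsHolder.of_eqOn {a L M : ℝ} (hL : 0 ≤ L) {J : Set ℝ} (hJ : J.OrdConnected) {f F : ℝ → ℝ}
    (hF : ContDiff ℝ ∞ F) (hinc : HolderIncrement a L F) (hfF : EqOn f F J)
    (hM : ∀ x ∈ J, |F x| ≤ M) : IsHolder a L M J f where
  contDiffOn _ := ((hF.of_le (by exact_mod_cast le_top)).contDiffOn).congr hfF
  bound x hx := by rw [hfF hx]; exact hM x hx
  holder x hx y hy hxy := by
    rcases eq_or_ne x y with rfl | hne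
    · simpa using mul_nonneg hL (Real.rpow_nonneg le_rfl _)
    have hU : UniqueDiffOn ℝ J := by
      refine uniqueDiffOn_convex hJ.convex ?_
      exact (hJ.convex.nontrivial_iff_nonempty_interior).1 ⟨x, hx, y, hy, hne⟩
    have e : ∀ z ∈ J, iteratedDerivWithin (holderOrder a) f J z =
        iteratedDeriv (holderOrder a) F z := fun z hz => by
      rw [iteratedDerivWithin_congr hfF hz, iteratedDerivWithin_eq_iteratedDeriv hU
        ((hF.of_le (by exact_mod_cast le_top)).contDiffAt) hz]
    rw [e x hx, e y hy]
    exact hinc x y hxy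

lemma exists_bound_iteratedDeriv {F : ℝ → ℝ} (hF : ContDiff ℝ ∞ F) (hc : HasCompactSupport F)
    (K : ℕ) : ∃ C : ℝ, 0 < C ∧ ∀ j ≤ K, ∀ x, |iteratedDeriv j F x| ≤ C := by
  have h : ∀ j : ℕ, ∃ C : ℝ, ∀ x, |iteratedDeriv j F x| ≤ C := by
    intro j
    obtain ⟨C, hC⟩ := (hc.iteratedFDeriv (𝕜 := ℝ) j).exists_bound_of_continuous
      (hF.continuous_iteratedFDeriv (by exact_mod_cast le_top))
    exact ⟨C, fun x => by
      rw [← Real.norm_eq_abs, ← norm_iteratedFDeriv_eq_norm_iteratedDeriv]; exact hC x⟩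
  choose C hC using h
  refine ⟨∑ j ∈ Finset.range (K + 1), |C j| + 1, by positivity, fun j hj x => ?_⟩
  have h1 : |C j| ≤ ∑ j ∈ Finset.range (K + 1), |C j| :=
    Finset.single_le_sum (f := fun j => |C j|) (fun _ _ => abs_nonneg _)
      (Finset.mem_range.2 (by omega))
  linarith [hC j x, le_abs_self (C j)]

/-! ### Waves and their superpositions -/

/-- A smooth bump that is `1` on `[-1/2, 1/2]` and vanishes outside `(-3/4, 3/4)`. -/
noncomputable def narrowBump : ContDiffBump (0 : ℝ) := ⟨1 / 2, 3 / 4, by norm_num, by norm_num⟩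

/-- An odd smooth function that is supported in `[-3/4, 3/4]`. -/
noncomputable def oddBump (u : ℝ) : ℝ := u * narrowBump u

lemma contDiff_oddBump : ContDiff ℝ ∞ oddBump := contDiff_id.mul narrowBump.contDiff

lemma oddBump_eq_zero {u : ℝ} (hu : 3 / 4 ≤ |u|) : oddBump u = 0 := by
  rw [oddBump, narrowBump.zero_of_le_dist (by simpa [narrowBump] using hu), mul_zero]

lemma oddBump_neg (u : ℝ) : oddBump (-u) = -oddBump u := by
  simp [oddBump, narrowBump.neg]

lemma abs_oddBump_le_one (u : ℝ) : |oddBump u| ≤ 1 := by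
  rcases le_total (3 / 4) |u| with h | h
  · simp [oddBump_eq_zero h]
  · rw [oddBump, abs_mul, abs_of_nonneg narrowBump.nonneg]
    nlinarith [narrowBump.le_one (x := u), narrowBump.nonneg (x := u), abs_nonneg u]

lemma le_oddBump {u : ℝ} (h1 : 1 / 4 ≤ u) (h2 : u ≤ 1 / 2) : 1 / 4 ≤ oddBump u := by
  rw [oddBump, narrowBump.one_of_mem_closedBall, mul_one]
  · exact h1
  · rw [mem_closedBall_zero_iff, Real.norm_eq_abs, abs_of_nonneg (by linarith)]
    exact h2

lemma hasCompactSupport_oddBump : HasCompactSupport oddBump := narrowBump.hasCompactSupport.mul_left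

/-- The support ends at 3/4 rather than 1, so the function vanishes near `u` even when `|u| = 1`,
where adjacent waves may meet. -/
lemma iteratedDeriv_oddBump_eq_zero (j : ℕ) {u : ℝ} (hu : 1 ≤ |u|) :
    iteratedDeriv j oddBump u = 0 := by
  have h : oddBump =ᶠ[nhds u] fun _ => 0 := by
    have : {v : ℝ | 3 / 4 < |v|} ∈ nhds u :=
      (isOpen_lt continuous_const continuous_abs).mem_nhds (by
        show 3 / 4 < |u|; linarith)
    filter_upwards [this] with v hv using oddBump_eq_zero (le_of_lt hv)
  rw [h.iteratedDeriv_eq]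
  simp

/-- The function `oddBump` moved to `t`, at scale `h` and with amplitude `A`. -/
noncomputable def wave (A h t x : ℝ) : ℝ := A * oddBump (h⁻¹ * (x - t))

lemma contDiff_wave (A h t : ℝ) : ContDiff ℝ ∞ (wave A h t) :=
  contDiff_const.mul (contDiff_oddBump.comp (contDiff_const.mul (contDiff_id.sub contDiff_const)))

lemma iteratedDeriv_wave (A h t : ℝ) (j : ℕ) (x : ℝ) :
    iteratedDeriv j (wave A h t) x = A * h⁻¹ ^ j * iteratedDeriv j oddBump (h⁻¹ * (x - t)) := by
  have e : wave A h t = fun x => A * (fun z => (fun w => oddBump (h⁻¹ * w)) (z - t)) x := rfl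
  rw [e, iteratedDeriv_const_mul_field, iteratedDeriv_comp_sub_const (f := fun w => oddBump (h⁻¹ * w))]
  rw [iteratedDeriv_comp_const_mul (contDiff_oddBump.of_le (by exact_mod_cast le_top)), mul_assoc]

lemma one_le_abs_scaled {h t x : ℝ} (h0 : 0 < h) (hx : h ≤ |x - t|) : 1 ≤ |h⁻¹ * (x - t)| := by
  rw [abs_mul, abs_of_pos (inv_pos.2 h0), inv_mul_eq_div, one_le_div h0]
  exact hx

lemma wave_eq_zero {A h t x : ℝ} (h0 : 0 < h) (hx : h ≤ |x - t|) : wave A h t x = 0 := by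
  rw [wave, oddBump_eq_zero (by linarith [one_le_abs_scaled h0 hx]), mul_zero]

lemma abs_wave_le {A : ℝ} (hA : 0 ≤ A) (h t x : ℝ) : |wave A h t x| ≤ A := by
  rw [wave, abs_mul, abs_of_nonneg hA]
  exact mul_le_of_le_one_right hA (abs_oddBump_le_one _)

lemma le_wave {A h t x : ℝ} (hA : 0 ≤ A) (h0 : 0 < h) (h1 : t + h / 4 ≤ x) (h2 : x ≤ t + h / 2) :
    A / 4 ≤ wave A h t x := by
  have := le_oddBump (u := h⁻¹ * (x - t)) (by rw [inv_mul_eq_div, le_div_iff₀ h0]; linarith)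
    (by rw [inv_mul_eq_div, div_le_iff₀ h0]; linarith)
  rw [wave]
  nlinarith

lemma hasCompactSupport_wave {h : ℝ} (h0 : 0 < h) (A t : ℝ) : HasCompactSupport (wave A h t) := by
  refine HasCompactSupport.intro (isCompact_Icc (a := t - h) (b := t + h)) fun x hx => ?_
  refine wave_eq_zero h0 ?_
  by_contra! hlt
  rw [abs_lt] at hlt
  exact hx ⟨by linarith, by linarith⟩

lemma integrable_wave {h : ℝ} (h0 : 0 < h) (A t : ℝ) : Integrable (wave A h t) :=
  (contDiff_wave A h t).continuous.integrable_of_hasCompactSupport (hasCompactSupport_wave h0 A t)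

/-- The reflection `x ↦ 2t - x` changes the sign of the wave. Adding waves therefore preserves total
mass. -/
lemma integral_wave (A h t : ℝ) : ∫ x, wave A h t x = 0 := by
  have h1 : ∀ x, wave A h t (2 * t - x) = -wave A h t x := by
    intro x
    rw [wave, wave, show h⁻¹ * (2 * t - x - t) = -(h⁻¹ * (x - t)) by ring, oddBump_neg]
    ring
  have h2 := integral_sub_left_eq_self (wave A h t) volume (2 * t)
  simp_rw [h1] at h2
  rw [integral_neg] at h2
  linarith

/-- If at most one term of a sum is nonzero, a bound of the terms is a bound of the sum. -/
lemma abs_sum_le_of_pairwise {ι : Type*} {S : Finset ι} {u : ι → ℝ} {C : ℝ} (hC : 0 ≤ C)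
    (hu : ∀ i, |u i| ≤ C) (hd : ∀ i j, i ≠ j → u i = 0 ∨ u j = 0) : |∑ i ∈ S, u i| ≤ C := by
  by_cases h : ∃ i ∈ S, u i ≠ 0
  · obtain ⟨i, hi, hne⟩ := h
    rw [Finset.sum_eq_single_of_mem i hi fun j _ hj => (hd j i hj).resolve_right hne]
    exact hu i
  · push Not at h
    rw [Finset.sum_eq_zero h]
    simpa using hC

/-- A superposition of waves. -/
noncomputable def waves {N : ℕ} (A h : ℝ) (t : Fin N → ℝ) (S : Finset (Fin N)) (x : ℝ) : ℝ :=
  ∑ k ∈ S, wave A h (t k) x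

section waves

variable {N : ℕ} {A h : ℝ} {t : Fin N → ℝ} {S : Finset (Fin N)}

lemma contDiff_waves : ContDiff ℝ ∞ (waves A h t S) :=
  ContDiff.sum fun k _ => contDiff_wave A h (t k)

/-- At each point at most one wave is active, so bounds of a single wave carry over to sums
irrespective of `N`. -/
lemma scale_le_abs_sub_or (ht : ∀ i j, i ≠ j → 2 * h ≤ |t i - t j|) {i j : Fin N} (hij : i ≠ j)
    (x : ℝ) : h ≤ |x - t i| ∨ h ≤ |x - t j| := by
  by_contra! hc
  have := abs_sub_le (t i) x (t j)
  rw [abs_sub_comm (t i) x] at this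
  linarith [ht i j hij, hc.1, hc.2]

lemma abs_iteratedDeriv_waves_le (hA : 0 ≤ A) (h0 : 0 < h)
    (ht : ∀ i j, i ≠ j → 2 * h ≤ |t i - t j|) {j : ℕ} {C : ℝ}
    (hC : ∀ u, |iteratedDeriv j oddBump u| ≤ C) (x : ℝ) :
    |iteratedDeriv j (waves A h t S) x| ≤ A * h⁻¹ ^ j * C := by
  have e : iteratedDeriv j (waves A h t S) x = ∑ k ∈ S, iteratedDeriv j (wave A h (t k)) x :=
    iteratedDeriv_fun_sum (f := fun k => wave A h (t k)) fun k _ =>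
      ((contDiff_wave A h (t k)).of_le (by exact_mod_cast le_top)).contDiffAt
  have hC0 : 0 ≤ C := (abs_nonneg _).trans (hC 0)
  rw [e]
  refine abs_sum_le_of_pairwise (by positivity) (fun k => ?_) fun i k hik => ?_
  · rw [iteratedDeriv_wave, abs_mul, abs_of_nonneg (by positivity : 0 ≤ A * h⁻¹ ^ j)]
    gcongr
    exact hC _
  · rw [iteratedDeriv_wave, iteratedDeriv_wave]
    refine (scale_le_abs_sub_or ht hik x).imp (fun hx => ?_) fun hx => ?_ <;>
    rw [iteratedDeriv_oddBump_eq_zero j (one_le_abs_scaled h0 hx), mul_zero]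

lemma abs_waves_le (hA : 0 ≤ A) (h0 : 0 < h) (ht : ∀ i j, i ≠ j → 2 * h ≤ |t i - t j|) (x : ℝ) :
    |waves A h t S x| ≤ A :=
  abs_sum_le_of_pairwise hA (fun k => abs_wave_le hA h (t k) x) fun _ _ hik =>
    (scale_le_abs_sub_or ht hik x).imp (wave_eq_zero h0) (wave_eq_zero h0)

lemma waves_eq_zero (h0 : 0 < h) {x : ℝ} (hx : ∀ k, h ≤ |x - t k|) : waves A h t S x = 0 :=
  Finset.sum_eq_zero fun k _ => wave_eq_zero h0 (hx k)

lemma integrable_waves (h0 : 0 < h) : Integrable (waves A h t S) :=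
  integrable_finsetSum _ fun k _ => integrable_wave h0 A (t k)

lemma integral_waves (h0 : 0 < h) : ∫ x, waves A h t S x = 0 := by
  unfold waves
  rw [integral_finsetSum _ fun k _ => integrable_wave h0 A (t k)]
  simp [integral_wave]

/-- Each derivative costs a factor `h⁻¹`, so the amplitude `A₀ h ^ a` leaves exactly the bounds `h ^
(a - j)` that the interpolation at scale `h` requires. -/
lemma holderIncrement_waves {a A₀ C : ℝ} (ha : 0 ≤ a) (hA : 0 ≤ A) (h0 : 0 < h)
    (hA₀ : A ≤ A₀ * h ^ a) (ht : ∀ i j, i ≠ j → 2 * h ≤ |t i - t j|)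
    (hC : ∀ j ≤ holderOrder a + 1, ∀ u, |iteratedDeriv j oddBump u| ≤ C) :
    HolderIncrement a (2 * (A₀ * C)) (waves A h t S) := by
  have hC0 : 0 ≤ C := (abs_nonneg _).trans (hC 0 (by omega) 0)
  have key : ∀ j ≤ holderOrder a + 1, ∀ x, |iteratedDeriv j (waves A h t S) x| ≤
      A₀ * C * h ^ (a - j) := by
    intro j hj x
    refine (abs_iteratedDeriv_waves_le hA h0 ht (hC j hj) x).trans ?_
    rw [Real.rpow_sub h0, Real.rpow_natCast, inv_pow, div_eq_mul_inv]
    calc A * (h ^ j)⁻¹ * C ≤ A₀ * h ^ a * (h ^ j)⁻¹ * C := by gcongr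
      _ = _ := by ring
  refine holderIncrement_of_scale ha contDiff_waves h0 (key _ (by omega)) fun x => ?_
  have := key (holderOrder a + 1) le_rfl x
  push_cast at this
  rwa [show a - holderOrder a - 1 = a - (holderOrder a + 1) by ring]

end waves

/-! ### The baseline density -/

/-- `φ`, restricted to `I`, is a smooth density that is constant on `[u, v]`, where it attains its
maximum `κ < M`, and whose derivatives of the orders `1, …, K` are at most `L / 2`. -/
structure IsBaseline (I : Set ℝ) (u v κ M L : ℝ) (K : ℕ) (φ : ℝ → ℝ) : Prop where
  contDiff : ContDiff ℝ ∞ φ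
  nonneg : ∀ x, 0 ≤ φ x
  le : ∀ x, φ x ≤ κ
  eq_const : ∀ x ∈ Icc u v, φ x = κ
  integrable : Integrable (I.indicator φ)
  integral_eq_one : ∫ x, I.indicator φ x = 1
  deriv_le : ∀ j, 1 ≤ j → j ≤ K → ∀ x, |iteratedDeriv j φ x| ≤ L / 2
  pos : 0 < κ
  lt : κ < M

/-- A smooth bump that is `1` on `[-1, 1]` and vanishes outside `(-2, 2)`. -/
noncomputable def wideBump : ContDiffBump (0 : ℝ) := ⟨1, 2, by norm_num, by norm_num⟩

lemma eventually_one_lt_mul_volume {I : Set ℝ} {M : ℝ} (hMI : 1 < ENNReal.ofReal M * volume I) :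
    ∀ᶠ S : ℕ in Filter.atTop,
      1 < ENNReal.ofReal M * volume (I ∩ Metric.closedBall (0 : ℝ) S) := by
  have hU : ⋃ S : ℕ, I ∩ Metric.closedBall (0 : ℝ) S = I := by
    rw [← inter_iUnion, Metric.iUnion_closedBall_nat, inter_univ]
  have hmono : Monotone fun S : ℕ => I ∩ Metric.closedBall (0 : ℝ) S := fun S T hST =>
    inter_subset_inter_right _ (Metric.closedBall_subset_closedBall (by exact_mod_cast hST))
  have h1 := tendsto_measure_iUnion_atTop (μ := volume) hmono
  rw [hU] at h1
  have h2 := ENNReal.Tendsto.const_mul h1 (Or.inr (ENNReal.ofReal_ne_top (r := M)))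
  exact h2.eventually_const_lt hMI

/-- Stretch a plateau by a large factor `S` and normalise its mass `Z` on `I`. Since `Z ≥ |I ∩ [-S,
S]|`, which exceeds `1 / M` for large `S`, the height `κ = 1 / Z` is below `M`; stretching makes the
derivatives small. Truncation to `I` costs no regularity, as smoothness is only measured within `I`.
-/
lemma exists_isBaseline {I : Set ℝ} (hI : I.OrdConnected) {L M : ℝ} (hL : 0 < L) (hM : 0 < M)
    (hMI : 1 < ENNReal.ofReal M * volume I) (u v : ℝ) (K : ℕ) :
    ∃ κ φ, IsBaseline I u v κ M L K φ := by
  have hIm : MeasurableSet I := hI.measurableSet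
  obtain ⟨C, hC0, hC⟩ := exists_bound_iteratedDeriv wideBump.contDiff wideBump.hasCompactSupport K
  -- In turn: `S⁻¹ ^ j ≤ S⁻¹` for `j ≥ 1`; `[u, v] ⊆ [-S, S]`; derivatives at most `M C / S ≤ L /
  -- 2`; and height below `M`.
  obtain ⟨S, ⟨⟨⟨hS1, hSu⟩, hSv⟩, hSC⟩, hSM⟩ := ((((Filter.eventually_ge_atTop 1).and
    ((Filter.eventually_ge_atTop ⌈-u⌉₊))).and (Filter.eventually_ge_atTop ⌈v⌉₊)).and
    (Filter.eventually_ge_atTop ⌈2 * M * C / L⌉₊) |>.and (eventually_one_lt_mul_volume hMI)).exists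
  have hS1' : (1 : ℝ) ≤ S := by exact_mod_cast hS1
  have hS0 : (0 : ℝ) < S := by linarith
  have hSu' := Nat.ceil_le.1 hSu
  have hSv' := Nat.ceil_le.1 hSv
  have hSC' := Nat.ceil_le.1 hSC
  set φ₀ : ℝ → ℝ := fun x => wideBump ((S : ℝ)⁻¹ * x) with hφ₀
  have hφs : ContDiff ℝ ∞ φ₀ := wideBump.contDiff.comp (contDiff_const.mul contDiff_id)
  have hone : ∀ x : ℝ, |x| ≤ S → φ₀ x = 1 := fun x hx => by
    refine wideBump.one_of_mem_closedBall ?_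
    rw [mem_closedBall_zero_iff, Real.norm_eq_abs, abs_mul, abs_of_pos (inv_pos.2 hS0),
      inv_mul_eq_div, div_le_iff₀ hS0]
    simpa [wideBump] using hx
  have hcs : HasCompactSupport φ₀ := by
    refine HasCompactSupport.intro (isCompact_closedBall (0 : ℝ) (2 * S)) fun x hx => ?_
    refine wideBump.zero_of_le_dist ?_
    rw [mem_closedBall_zero_iff, Real.norm_eq_abs, not_le] at hx
    rw [dist_zero_right, Real.norm_eq_abs, abs_mul, abs_of_pos (inv_pos.2 hS0),
      inv_mul_eq_div, le_div_iff₀ hS0]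
    simpa [wideBump] using hx.le
  have hint : Integrable (I.indicator φ₀) :=
    (hφs.continuous.integrable_of_hasCompactSupport hcs).indicator hIm
  set Z := ∫ x, I.indicator φ₀ x with hZ
  have hZvol : volume (I ∩ Metric.closedBall (0 : ℝ) S) ≤ ENNReal.ofReal Z := by
    rw [hZ, ofReal_integral_eq_lintegral_ofReal hint
      (Filter.Eventually.of_forall fun x => indicator_nonneg (fun _ _ => wideBump.nonneg) x),
      ← lintegral_indicator_one (hIm.inter Metric.isClosed_closedBall.measurableSet)]
    refine lintegral_mono fun x => ?_
    by_cases hx : x ∈ I ∩ Metric.closedBall (0 : ℝ) S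
    · have h1 := hone x (by simpa using hx.2)
      simp [indicator_of_mem hx, indicator_of_mem hx.1, h1]
    · simp [indicator_of_notMem hx]
  have hMZ : 1 < M * Z := by
    have h1 : 1 < ENNReal.ofReal M * ENNReal.ofReal Z :=
      hSM.trans_le (by gcongr)
    rw [← ENNReal.ofReal_mul hM.le, ENNReal.one_lt_ofReal] at h1
    exact h1
  have hZ0 : 0 < Z := by
    by_contra! h
    nlinarith
  have hκM : Z⁻¹ < M := by
    rw [inv_lt_iff_one_lt_mul₀ hZ0]; exact hMZ
  refine ⟨Z⁻¹, fun x => Z⁻¹ * φ₀ x, ?_⟩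
  have hind : I.indicator (fun x => Z⁻¹ * φ₀ x) = fun x => Z⁻¹ * I.indicator φ₀ x := by
    funext x
    by_cases hx : x ∈ I <;> simp [hx]
  refine ⟨contDiff_const.mul hφs, fun x => mul_nonneg (inv_pos.2 hZ0).le wideBump.nonneg,
    fun x => mul_le_of_le_one_right (inv_pos.2 hZ0).le wideBump.le_one, fun x hx => ?_, ?_, ?_,
    fun j hj1 hjK x => ?_, inv_pos.2 hZ0, hκM⟩
  · rw [hone x (abs_le.2 ⟨by linarith [hx.1], by linarith [hx.2]⟩), mul_one]
  · rw [hind]; exact hint.const_mul _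
  · rw [hind, integral_const_mul, ← hZ, inv_mul_cancel₀ hZ0.ne']
  · rw [iteratedDeriv_const_mul_field, hφ₀,
      iteratedDeriv_comp_const_mul (wideBump.contDiff.of_le (by exact_mod_cast le_top))]
    rw [abs_mul, abs_mul, abs_of_pos (inv_pos.2 hZ0), abs_of_pos (by positivity)]
    have h1 : ((S : ℝ)⁻¹) ^ j ≤ (S : ℝ)⁻¹ :=
      pow_le_of_le_one (by positivity) (inv_le_one_of_one_le₀ hS1') (by omega)
    calc Z⁻¹ * (((S : ℝ)⁻¹) ^ j * |iteratedDeriv j wideBump ((S : ℝ)⁻¹ * x)|)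
        ≤ M * ((S : ℝ)⁻¹ * C) := by
          gcongr
          exact hC j hjK _
      _ ≤ L / 2 := by
          rw [div_le_iff₀ hL] at hSC'
          rw [inv_mul_eq_div, mul_div_assoc', div_le_div_iff₀ hS0 two_pos]
          linarith

/-! ### Perturbed densities and their minimax bound -/

/-- The baseline density plus a superposition of waves. -/
noncomputable def perturbed (I : Set ℝ) (φ : ℝ → ℝ) {N : ℕ} (A h : ℝ) (t : Fin N → ℝ)
    (S : Finset (Fin N)) (x : ℝ) : ℝ :=
  I.indicator φ x + waves A h t S x

/-- The waves with the centres `t` and the scale `h` have disjoint supports in `[u, v]`. -/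
structure IsPacked (u v h : ℝ) {N : ℕ} (t : Fin N → ℝ) : Prop where
  pos : 0 < h
  separated : ∀ i j, i ≠ j → 2 * h ≤ |t i - t j|
  left_le : ∀ k, u ≤ t k - h
  le_right : ∀ k, t k + h ≤ v

lemma IsPacked.waves_eq_zero {u v h : ℝ} {N : ℕ} {t : Fin N → ℝ} (ht : IsPacked u v h t) {x : ℝ}
    (hx : x ∉ Icc u v) (A : ℝ) (S : Finset (Fin N)) : waves A h t S x = 0 := by
  refine _root_.waves_eq_zero ht.pos fun k => ?_
  by_contra! hlt
  rw [abs_lt] at hlt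
  exact hx ⟨by linarith [ht.left_le k], by linarith [ht.le_right k]⟩

section perturbed

variable {I : Set ℝ} {u v κ M L : ℝ} {K : ℕ} {φ : ℝ → ℝ} {N : ℕ} {A h : ℝ} {t : Fin N → ℝ}
  {S : Finset (Fin N)}

lemma measurable_perturbed (hφ : IsBaseline I u v κ M L K φ) (hI : I.OrdConnected) :
    Measurable (perturbed I φ A h t S) :=
  (hφ.contDiff.continuous.measurable.indicator hI.measurableSet).add
    contDiff_waves.continuous.measurable

lemma perturbed_apply (hφ : IsBaseline I u v κ M L K φ) (huv : Icc u v ⊆ I) {x : ℝ}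
    (hx : x ∈ Icc u v) : perturbed I φ A h t S x = κ + waves A h t S x := by
  rw [perturbed, indicator_of_mem (huv hx), hφ.eq_const x hx]

lemma half_le_perturbed (hφ : IsBaseline I u v κ M L K φ) (huv : Icc u v ⊆ I)
    (ht : IsPacked u v h t) (hA : 0 ≤ A) (hAκ : A ≤ κ / 2) {x : ℝ} (hx : x ∈ Icc u v) :
    κ / 2 ≤ perturbed I φ A h t S x := by
  rw [perturbed_apply hφ huv hx]
  linarith [(abs_le.1 (abs_waves_le (S := S) hA ht.pos ht.separated x)).1]

lemma perturbed_nonneg (hφ : IsBaseline I u v κ M L K φ) (huv : Icc u v ⊆ I)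
    (ht : IsPacked u v h t) (hA : 0 ≤ A) (hAκ : A ≤ κ / 2) (x : ℝ) :
    0 ≤ perturbed I φ A h t S x := by
  by_cases hx : x ∈ Icc u v
  · exact (half_pos hφ.pos).le.trans (half_le_perturbed hφ huv ht hA hAκ hx)
  · rw [perturbed, ht.waves_eq_zero hx, add_zero]
    exact indicator_nonneg (fun _ _ => hφ.nonneg _) x

lemma isDensityOn_perturbed (hφ : IsBaseline I u v κ M L K φ) (hI : I.OrdConnected)
    (huv : Icc u v ⊆ I) (ht : IsPacked u v h t) (hA : 0 ≤ A) (hAκ : A ≤ κ / 2) :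
    IsDensityOn I (perturbed I φ A h t S) where
  measurable := measurable_perturbed hφ hI
  nonneg := perturbed_nonneg hφ huv ht hA hAκ
  supported x hx := by
    rw [perturbed, ht.waves_eq_zero (fun h => hx (huv h)), indicator_of_notMem hx, add_zero]
  lintegral_eq_one := by
    have hint : Integrable (perturbed I φ A h t S) := hφ.integrable.add (integrable_waves ht.pos)
    rw [← ofReal_integral_eq_lintegral_ofReal hint
      (Filter.Eventually.of_forall (perturbed_nonneg hφ huv ht hA hAκ))]
    have : ∫ x, perturbed I φ A h t S x = 1 := by
      unfold perturbed
      rw [integral_add hφ.integrable (integrable_waves ht.pos), hφ.integral_eq_one,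
        integral_waves ht.pos, add_zero]
    rw [this, ENNReal.ofReal_one]

/-- The Hölder budget `L` is split evenly between baseline and waves. The waves live where the
baseline equals `κ`, so `A ≤ M - κ` keeps the sum below `M`. -/
lemma isHolder_perturbed (hφ : IsBaseline I u v κ M L K φ) (hL : 0 < L)
    (ht : IsPacked u v h t) (hA : 0 ≤ A) (hAκ : A ≤ κ / 2) (hAM : A ≤ M - κ)
    {a A₀ C : ℝ} (ha : 0 ≤ a) (haK : holderOrder a + 1 ≤ K) (hA₀ : A ≤ A₀ * h ^ a)
    (hC : ∀ j ≤ K, ∀ x, |iteratedDeriv j oddBump x| ≤ C) (hAC : 2 * (A₀ * C) ≤ L / 2)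
    {J : Set ℝ} (hJ : J.OrdConnected) (hJI : J ⊆ I) :
    IsHolder a L M J (perturbed I φ A h t S) := by
  have h1 : HolderIncrement a (L / 2) φ :=
    holderIncrement_of_deriv_le hφ.contDiff (hφ.deriv_le _ (by omega) haK)
  have h2 : HolderIncrement a (L / 2) (waves A h t S) :=
    (holderIncrement_waves ha hA ht.pos hA₀ ht.separated fun j hj => hC j (hj.trans haK)).mono hAC
  have h3 := h1.add h2 hφ.contDiff contDiff_waves
  rw [add_halves] at h3
  refine IsHolder.of_eqOn hL.le hJ (hφ.contDiff.add contDiff_waves) h3 (fun x hx => ?_) fun x _ => ?_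
  · simp [perturbed, hJI hx]
  · have hw := abs_le.1 (abs_waves_le (S := S) hA ht.pos ht.separated x)
    by_cases hx : x ∈ Icc u v
    · rw [hφ.eq_const x hx, abs_le]
      constructor <;> linarith [hφ.pos, hφ.lt]
    · rw [ht.waves_eq_zero hx, add_zero, abs_of_nonneg (hφ.nonneg x)]
      exact (hφ.le x).trans hφ.lt.le

/-- Where the waves vanish, only the regularity of the baseline matters. -/
lemma isHolder_perturbed_of_waves_eq_zero (hφ : IsBaseline I u v κ M L K φ) (hL : 0 < L)
    {a : ℝ} (haK : holderOrder a + 1 ≤ K) {J : Set ℝ} (hJ : J.OrdConnected) (hJI : J ⊆ I)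
    (hw : ∀ x ∈ J, waves A h t S x = 0) :
    IsHolder a L M J (perturbed I φ A h t S) := by
  have h1 : HolderIncrement a (L / 2) φ :=
    holderIncrement_of_deriv_le hφ.contDiff (hφ.deriv_le _ (by omega) haK)
  refine IsHolder.of_eqOn hL.le hJ hφ.contDiff (h1.mono (by linarith)) (fun x hx => ?_) fun x _ => ?_
  · simp [perturbed, hJI hx, hw x hx]
  · rw [abs_of_nonneg (hφ.nonneg x)]
    exact (hφ.le x).trans hφ.lt.le

lemma perturbed_insert_sub {k : Fin N} (hk : k ∉ S) (x : ℝ) :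
    perturbed I φ A h t (insert k S) x - perturbed I φ A h t S x = wave A h (t k) x := by
  rw [perturbed, perturbed, waves, waves, Finset.sum_insert hk]
  ring

/-- The minimax lower bound for a class that contains all perturbations of the baseline. -/
lemma le_minimaxRisk_of_perturbed_mem (hφ : IsBaseline I u v κ M L K φ) (hI : I.OrdConnected)
    (huv : Icc u v ⊆ I) {I₀ : Set ℝ} (huv₀ : Icc u v ⊆ I₀) (ht : IsPacked u v h t) (hA : 0 ≤ A)
    (hAκ : A ≤ κ / 2) {n : ℕ} (hn : 1 ≤ n) (hAn : 8 * A ^ 2 * h * n ≤ κ) {p : ℝ} (hp : 1 ≤ p)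
    {H : Set (ℝ → ℝ)} (hH : ∀ S, perturbed I φ A h t S ∈ H) :
    ENNReal.ofReal (N * ((A / 4) ^ p * (h / 4)) / (2 * 2 ^ p)) ≤ minimaxRisk p I₀ n H := by
  have hn' : (0 : ℝ) < n := by exact_mod_cast hn
  have hh := ht.pos
  have hκ := hφ.pos
  set B : Fin N → Set ℝ := fun k => Ioo (t k - h) (t k + h) with hB
  have hBuv : ∀ k, B k ⊆ Icc u v := fun k x hx =>
    ⟨(ht.left_le k).trans hx.1.le, hx.2.le.trans (ht.le_right k)⟩
  have hBabs : ∀ k x, x ∈ B k ↔ |x - t k| < h := fun k x => by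
    rw [abs_lt, hB]
    simp only [mem_Ioo]
    constructor <;> rintro ⟨h1, h2⟩ <;> constructor <;> linarith
  have hdisj : Pairwise (Function.onFun Disjoint B) := fun i j hij => by
    refine Set.disjoint_left.2 fun x hi hj => ?_
    rcases scale_le_abs_sub_or ht.separated hij x with h1 | h1
    · exact absurd ((hBabs i x).1 hi) (not_lt.2 h1)
    · exact absurd ((hBabs j x).1 hj) (not_lt.2 h1)
  have hdens : ∀ S, IsDensityOn I (perturbed I φ A h t S) := fun S =>
    isDensityOn_perturbed hφ hI huv ht hA hAκ
  refine le_iInf₂ fun fhat hfhat => ?_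
  set T := ⨆ f ∈ H, lpRisk p I₀ n fhat f with hT
  have hs : ∀ (S : Finset (Fin N)) (k : Fin N), k ∉ S →
      ENNReal.ofReal ((A / 4) ^ p * (h / 4)) ≤ ∫⁻ x in B k, ENNReal.ofReal
        (|perturbed I φ A h t (insert k S) x - perturbed I φ A h t S x| ^ p) := by
    intro S k hk
    -- On this interval of length `h / 4` the wave is at least `A / 4`.
    have hsub : Icc (t k + h / 4) (t k + h / 2) ⊆ B k := fun x hx =>
      ⟨by linarith [hx.1], by linarith [hx.2]⟩
    calc ENNReal.ofReal ((A / 4) ^ p * (h / 4))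
        = ∫⁻ _ in Icc (t k + h / 4) (t k + h / 2), ENNReal.ofReal ((A / 4) ^ p) := by
          rw [setLIntegral_const, Real.volume_Icc, ENNReal.ofReal_mul (by positivity)]
          congr 2
          ring
      _ ≤ ∫⁻ x in Icc (t k + h / 4) (t k + h / 2), ENNReal.ofReal
            (|perturbed I φ A h t (insert k S) x - perturbed I φ A h t S x| ^ p) := by
          refine setLIntegral_mono' measurableSet_Icc fun x hx => ?_
          rw [perturbed_insert_sub hk]
          refine ENNReal.ofReal_le_ofReal (Real.rpow_le_rpow (by positivity) ?_ (by linarith))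
          exact (le_wave hA hh hx.1 hx.2).trans (le_abs_self _)
      _ ≤ _ := lintegral_mono_set hsub
  have key := assouad hn hp (I₀ := I₀) (B := B) (fun k => measurableSet_Ioo) hdisj
    (fun k => (hBuv k).trans huv₀) (F := perturbed I φ A h t) (fun S => (hdens S).measurable)
    (fun S => (hdens S).nonneg) (fun S => (hdens S).lintegral_eq_one) (half_pos hκ)
    (fun S k x hx => half_le_perturbed hφ huv ht hA hAκ (hBuv k hx))
    (fun S k hk x hx => by
      have h1 := perturbed_insert_sub (I := I) (φ := φ) (A := A) (h := h) (t := t) hk x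
      rw [wave_eq_zero hh (not_lt.1 fun hlt => hx ((hBabs k x).2 hlt))] at h1
      linarith)
    (D := A) (fun S k hk x _ => by rw [perturbed_insert_sub hk]; exact abs_wave_le hA h _ x)
    (w := 2 * h) (fun k => by
      rw [hB, Real.volume_Ioo]
      exact ENNReal.ofReal_le_ofReal (by linarith))
    (by
      -- With density at least `κ / 2`, difference at most `A` and width `2h`, the chi-square bound
      -- is `4 A² h / κ`; this is where `8 A² h n ≤ κ` enters.
      rw [div_mul_eq_mul_div, div_le_div_iff₀ (half_pos hκ) (by positivity)]
      linarith) hs hfhat (T := T) (fun S => le_iSup₂_of_le _ (hH S) le_rfl)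
  have h2p : (0 : ℝ) < 2 * 2 ^ p := by positivity
  rw [ENNReal.ofReal_div_of_pos h2p]
  refine ENNReal.div_le_of_le_mul' ?_
  rw [ENNReal.ofReal_mul (by positivity), ENNReal.ofReal_natCast]
  refine key.trans_eq ?_
  rw [ENNReal.ofReal_mul two_pos.le, ENNReal.ofReal_ofNat]
  ring

end perturbed

/-! ### Break points and packings -/

lemma ordConnected_piece {I : Set ℝ} (hI : I.OrdConnected) (ε : ℝ) {m : ℕ} (x : Fin m → ℝ)
    (i : Fin (m + 1)) : (piece I ε x i).OrdConnected :=
  ⟨fun _ hy _ hz _ hw => ⟨hI.out hy.1 hz.1 hw, fun j =>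
    ⟨fun h => ((hy.2 j).1 h).trans hw.1, fun h => hw.2.trans ((hz.2 j).2 h)⟩⟩⟩

/-- Read contrapositively: a point closer than `ε` to some break point lies in no piece. This is how
a rough wave escapes the condition of order `α`. -/
lemma le_abs_sub_of_mem_piece {I : Set ℝ} {ε : ℝ} {m : ℕ} {x : Fin m → ℝ} {i : Fin (m + 1)}
    {y : ℝ} (hy : y ∈ piece I ε x i) (j : Fin m) : ε ≤ |y - x j| := by
  rcases lt_or_ge j.castSucc i with h | h
  · exact le_trans (by linarith [(hy.2 j).1 h]) (le_abs_self _)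
  · exact le_trans (by linarith [(hy.2 j).2 h]) (neg_le_abs _)

/-- The first point is `c` and the others follow within a small ball. Only the one at `c` has to
hide a wave; the rest merely bring the count to `m`. -/
lemma exists_strictMono_mem_of_isOpen {U : Set ℝ} (hU : IsOpen U) {c : ℝ} (hc : c ∈ U) (m : ℕ) :
    ∃ x : Fin m → ℝ, StrictMono x ∧ (∀ j, x j ∈ U) ∧ (1 ≤ m → ∃ j, x j = c) := by
  obtain ⟨δ, hδ, hball⟩ := Metric.isOpen_iff.1 hU c hc
  have hm : (0 : ℝ) < m + 1 := by positivity
  refine ⟨fun j => c + δ * (j / (m + 1)), fun i j hij => ?_, fun j => hball ?_, fun h1 =>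
    ⟨⟨0, h1⟩, by simp⟩⟩
  · have : ((i : ℕ) : ℝ) < (j : ℕ) := by exact_mod_cast hij
    simp only
    gcongr
  · have hj : ((j : ℕ) : ℝ) < m + 1 := by
      have : ((j : ℕ) : ℝ) < m := by exact_mod_cast j.2
      linarith
    rw [Metric.mem_ball, Real.dist_eq, add_sub_cancel_left, abs_of_nonneg (by positivity)]
    exact mul_lt_of_lt_one_right hδ ((div_lt_one hm).2 hj)

lemma exists_strictMono_fine {u v ε : ℝ} (huv : u < v) (hε : 0 < ε) :
    ∃ (m : ℕ) (x : Fin m → ℝ), StrictMono x ∧ (∀ j, x j ∈ Icc u v) ∧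
      ∀ y ∈ Icc u v, ∃ j, |y - x j| < ε := by
  obtain ⟨N, hN⟩ := exists_nat_gt ((v - u) / ε)
  have hN0 : (0 : ℝ) < N := lt_trans (div_pos (sub_pos.2 huv) hε) hN
  set δ := (v - u) / N with hδ
  have hδ0 : 0 < δ := div_pos (sub_pos.2 huv) hN0
  have hδε : δ < ε := by
    rw [hδ, div_lt_iff₀ hN0]
    rw [div_lt_iff₀ hε] at hN
    linarith
  have hδN : N * δ = v - u := by rw [hδ]; field_simp
  refine ⟨N + 1, fun j => u + j * δ, fun i j hij => ?_, fun j => ?_, fun y hy => ?_⟩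
  · have : ((i : ℕ) : ℝ) < (j : ℕ) := by exact_mod_cast hij
    simp only
    gcongr
  · have hj : ((j : ℕ) : ℝ) ≤ N := by exact_mod_cast Nat.lt_succ_iff.1 j.2
    refine ⟨by simp only; nlinarith [mul_nonneg (Nat.cast_nonneg (α := ℝ) (j : ℕ)) hδ0.le], ?_⟩
    have := mul_le_mul_of_nonneg_right hj hδ0.le
    simp only
    linarith
  · have hq0 : 0 ≤ (y - u) / δ := div_nonneg (sub_nonneg.2 hy.1) hδ0.le
    have hq : ⌊(y - u) / δ⌋₊ < N + 1 := by
      rw [Nat.floor_lt hq0, div_lt_iff₀ hδ0]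
      push_cast
      nlinarith [hy.2]
    -- The last grid point to the left of `y` is at distance less than the mesh; the index `N` is
    -- needed for `y = v`.
    refine ⟨⟨_, hq⟩, ?_⟩
    have h1 := Nat.floor_le hq0
    have h2 := Nat.lt_floor_add_one ((y - u) / δ)
    rw [le_div_iff₀ hδ0] at h1
    rw [div_lt_iff₀ hδ0] at h2
    simp only
    rw [abs_lt]
    constructor <;> nlinarith

lemma densityClassOfCard_subset (m : ℕ) (α β L M ε : ℝ) (I : Set ℝ) :
    densityClassOfCard m α β L M ε I ⊆ densityClass α β L M ε I :=
  fun _ hf => ⟨hf.1, hf.2.1, m, hf.2.2⟩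

lemma minimaxRisk_mono (p : ℝ) (I₀ : Set ℝ) (n : ℕ) {H H' : Set (ℝ → ℝ)} (h : H ⊆ H') :
    minimaxRisk p I₀ n H ≤ minimaxRisk p I₀ n H' :=
  iInf₂_mono fun _ _ => biSup_mono h

lemma isPacked_equispaced {u v h : ℝ} (h0 : 0 < h) {N : ℕ} (hN : N * (2 * h) ≤ v - u) :
    IsPacked u v h fun k : Fin N => u + h + k * (2 * h) where
  pos := h0
  separated i j hij := by
    have e : u + h + i * (2 * h) - (u + h + j * (2 * h)) = ((i : ℕ) - (j : ℕ) : ℝ) * (2 * h) := by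
      ring
    have hij' : ((i : ℕ) : ℤ) - (j : ℕ) ≠ 0 := by
      have := Fin.val_ne_of_ne hij
      omega
    have h1 : (1 : ℝ) ≤ |((i : ℕ) - (j : ℕ) : ℝ)| := by
      have := Int.one_le_abs hij'
      exact_mod_cast this
    rw [e, abs_mul, abs_of_pos (by linarith : 0 < 2 * h)]
    nlinarith
  left_le k := by
    have : 0 ≤ ((k : ℕ) : ℝ) * (2 * h) := by positivity
    linarith
  le_right k := by
    have hk : ((k : ℕ) : ℝ) + 1 ≤ N := by exact_mod_cast k.2
    nlinarith

/-! ### Rates at a given scale -/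

section rates

variable {I I₀ : Set ℝ} {u v κ M L : ℝ} {K : ℕ} {φ : ℝ → ℝ} {p A₀ : ℝ}

/-- The lower bound for waves whose amplitude is `A₀ h ^ a`, with `n h ^ (2 a + 1) ≤ 1`. -/
lemma le_minimaxRisk_of_scale (hφ : IsBaseline I u v κ M L K φ) (hI : I.OrdConnected)
    (huv : Icc u v ⊆ I) (huv₀ : Icc u v ⊆ I₀) (hp : 1 ≤ p) (hA₀ : 0 ≤ A₀) (hA₀1 : A₀ ≤ 1)
    (hA₀κ : 8 * A₀ ≤ κ) {a h : ℝ} (ha : 0 ≤ a) (h1 : h ≤ 1) {n : ℕ} (hn : 1 ≤ n)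
    (hhn : h ^ (2 * a + 1) * n ≤ 1) {N : ℕ} {t : Fin N → ℝ} (ht : IsPacked u v h t)
    {H : Set (ℝ → ℝ)} (hH : ∀ S, perturbed I φ (A₀ * h ^ a) h t S ∈ H) :
    ENNReal.ofReal ((A₀ / 4) ^ p / (8 * 2 ^ p) * (N * h * h ^ (a * p))) ≤
      minimaxRisk p I₀ n H := by
  have h0 := ht.pos
  have hha0 : 0 ≤ h ^ a := Real.rpow_nonneg h0.le a
  have hha1 : h ^ a ≤ 1 := Real.rpow_le_one h0.le h1 ha
  have hA : 0 ≤ A₀ * h ^ a := mul_nonneg hA₀ hha0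
  have hAκ : A₀ * h ^ a ≤ κ / 2 := by nlinarith
  have hpow : (h ^ a) ^ 2 * h = h ^ (2 * a + 1) := by
    rw [Real.rpow_add_one h0.ne', mul_comm 2 a, Real.rpow_mul h0.le]
    norm_cast
  -- The left side is `8 A₀² (n h ^ (2a + 1)) ≤ 8 A₀² ≤ 8 A₀`.
  have hAn : 8 * (A₀ * h ^ a) ^ 2 * h * n ≤ κ := by
    have e : 8 * (A₀ * h ^ a) ^ 2 * h * n = 8 * A₀ ^ 2 * (h ^ (2 * a + 1) * n) := by
      rw [← hpow]; ring
    have : A₀ ^ 2 ≤ A₀ := by nlinarith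
    rw [e]
    nlinarith [mul_le_mul_of_nonneg_left hhn (sq_nonneg A₀)]
  refine le_trans (le_of_eq ?_)
    (le_minimaxRisk_of_perturbed_mem hφ hI huv huv₀ ht hA hAκ hn hAn hp hH)
  congr 1
  rw [show A₀ * h ^ a / 4 = A₀ / 4 * h ^ a by ring, Real.mul_rpow (by positivity) hha0,
    ← Real.rpow_mul h0.le]
  have : (2 : ℝ) ^ p ≠ 0 := by positivity
  field_simp
  ring

lemma scale_pow_mul_le_one {a h₀ : ℝ} (ha : 0 ≤ a) (h0 : 0 < h₀) (h1 : h₀ ≤ 1) {n : ℕ}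
    (hn : 1 ≤ n) : (h₀ * (n : ℝ) ^ (-(1 / (2 * a + 1)))) ^ (2 * a + 1) * n ≤ 1 := by
  have hn' : (0 : ℝ) < n := by exact_mod_cast hn
  have h2a : 2 * a + 1 ≠ 0 := by positivity
  rw [Real.mul_rpow h0.le (by positivity), ← Real.rpow_mul hn'.le,
    show -(1 / (2 * a + 1)) * (2 * a + 1) = -1 by field_simp, Real.rpow_neg_one, mul_assoc,
    inv_mul_cancel₀ hn'.ne', mul_one]
  exact Real.rpow_le_one h0.le h1 (by linarith)

lemma scale_rpow {a h₀ : ℝ} (h0 : 0 < h₀) (n : ℕ) (q : ℝ) :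
    (h₀ * (n : ℝ) ^ (-(1 / (2 * a + 1)))) ^ q = h₀ ^ q * (n : ℝ) ^ (-(q / (2 * a + 1))) := by
  rw [Real.mul_rpow h0.le (by positivity), ← Real.rpow_mul (Nat.cast_nonneg n)]
  congr 2
  ring

/-- The rate of a single wave, of the smoothness `β` of the density near the break points. -/
lemma rough_rate_le_minimaxRisk (hφ : IsBaseline I u v κ M L K φ) (hI : I.OrdConnected)
    (huv : Icc u v ⊆ I) (huv₀ : Icc u v ⊆ I₀) (hp : 1 ≤ p) (hA₀ : 0 ≤ A₀) (hA₀1 : A₀ ≤ 1)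
    (hA₀κ : 8 * A₀ ≤ κ) {β h₀ : ℝ} (hβ : 0 ≤ β) (h0 : 0 < h₀) (h1 : h₀ ≤ 1) {n : ℕ} (hn : 1 ≤ n)
    {h : ℝ} (hh : h = h₀ * (n : ℝ) ^ (-(1 / (2 * β + 1)))) (hh1 : h ≤ 1)
    {t : Fin 1 → ℝ} (ht : IsPacked u v h t)
    {H : Set (ℝ → ℝ)} (hH : ∀ S, perturbed I φ (A₀ * h ^ β) h t S ∈ H) :
    ENNReal.ofReal ((A₀ / 4) ^ p / (8 * 2 ^ p) * h₀ ^ (p * β + 1) *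
      (n : ℝ) ^ (-((p * β + 1) / (2 * β + 1)))) ≤ minimaxRisk p I₀ n H := by
  refine le_trans (le_of_eq ?_) (le_minimaxRisk_of_scale hφ hI huv huv₀ hp hA₀ hA₀1 hA₀κ hβ hh1 hn
    (by rw [hh]; exact scale_pow_mul_le_one hβ h0 h1 hn) ht hH)
  rw [mul_assoc, ← scale_rpow h0, ← hh, Real.rpow_add_one ht.pos.ne', mul_comm p β]
  congr 2
  push_cast
  ring

/-- The rate of a packing by waves, of the smoothness `α` away from the break points. -/
lemma smooth_rate_le_minimaxRisk (hφ : IsBaseline I u v κ M L K φ) (hI : I.OrdConnected)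
    (huv : Icc u v ⊆ I) (huv₀ : Icc u v ⊆ I₀) (hp : 1 ≤ p) (hA₀ : 0 ≤ A₀) (hA₀1 : A₀ ≤ 1)
    (hA₀κ : 8 * A₀ ≤ κ) {α h₀ : ℝ} (hα : 0 ≤ α) (h0 : 0 < h₀) (h1 : h₀ ≤ 1) {n : ℕ} (hn : 1 ≤ n)
    {h : ℝ} (hh : h = h₀ * (n : ℝ) ^ (-(1 / (2 * α + 1)))) (hh1 : h ≤ 1)
    {N : ℕ} (hN : (v - u) / 4 ≤ N * h) {t : Fin N → ℝ} (ht : IsPacked u v h t)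
    {H : Set (ℝ → ℝ)} (hH : ∀ S, perturbed I φ (A₀ * h ^ α) h t S ∈ H) :
    ENNReal.ofReal ((A₀ / 4) ^ p / (8 * 2 ^ p) * ((v - u) / 4 * h₀ ^ (p * α)) *
      (n : ℝ) ^ (-(p * α / (2 * α + 1)))) ≤ minimaxRisk p I₀ n H := by
  refine le_trans (ENNReal.ofReal_le_ofReal ?_)
    (le_minimaxRisk_of_scale hφ hI huv huv₀ hp hA₀ hA₀1 hA₀κ hα hh1 hn
      (by rw [hh]; exact scale_pow_mul_le_one hα h0 h1 hn) ht hH)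
  rw [mul_assoc, mul_assoc ((v - u) / 4), ← scale_rpow h0, ← hh, mul_comm p α]
  have := ht.pos
  gcongr

end rates

/-! ### Choice of constants and conclusion -/

lemma exists_Icc_subset_interior {I₀ : Set ℝ} (h : (interior I₀).Nonempty) :
    ∃ u v : ℝ, u < v ∧ Icc u v ⊆ interior I₀ := by
  obtain ⟨x, hx⟩ := h
  obtain ⟨δ, hδ, hball⟩ := Metric.isOpen_iff.1 isOpen_interior x hx
  refine ⟨x - δ / 2, x + δ / 2, by linarith, fun y hy => hball ?_⟩
  rw [Metric.mem_ball, Real.dist_eq, abs_lt]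
  constructor <;> linarith [hy.1, hy.2]

/-- Rounding down a number that is at least 1 loses at most a factor 2, whence the quarter. -/
lemma exists_packing_number {u v h : ℝ} (h0 : 0 < h) (hh : 2 * h ≤ v - u) :
    ∃ N : ℕ, N * (2 * h) ≤ v - u ∧ (v - u) / 4 ≤ N * h := by
  have h2 : (0 : ℝ) < 2 * h := by linarith
  refine ⟨⌊(v - u) / (2 * h)⌋₊, ?_, ?_⟩
  · exact (le_div_iff₀ h2).1 (Nat.floor_le (div_nonneg (by linarith) h2.le))
  · have h3 := Nat.lt_floor_add_one ((v - u) / (2 * h))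
    have h4 : (1 : ℝ) ≤ ⌊(v - u) / (2 * h)⌋₊ := by
      exact_mod_cast Nat.le_floor (by rw [Nat.cast_one, le_div_iff₀ h2]; linarith)
    rw [div_lt_iff₀ h2] at h3
    nlinarith

theorem theorem2 (α β L M p : ℝ) (hα : 1 ≤ α) (hβ : 0 ≤ β) (hβα : β < α)
    (hL : 0 < L) (hM : 0 < M) (hp : 1 ≤ p)
    (I I₀ : Set ℝ) (hI : I.OrdConnected) (hMI : 1 < ENNReal.ofReal M * volume I)
    (hI₀ : I₀.OrdConnected) (hI₀b : Bornology.IsBounded I₀) (hI₀n : (interior I₀).Nonempty)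
    (hI₀I : I₀ ⊆ I) :
    ∃ c : ℝ, 0 < c ∧ ∀ ε : ℝ, 0 < ε → ∀ n : ℕ, 1 ≤ n →
      ENNReal.ofReal (c * lowerRate p α β n) ≤ minimaxRisk p I₀ n (densityClass α β L M ε I) ∧
      ((n : ℝ) ^ (-(1 / (2 * β + 1))) ≤ ε → ∀ m : ℕ, 1 ≤ m →
        ENNReal.ofReal (c * lowerRate p α β n) ≤
          minimaxRisk p I₀ n (densityClassOfCard m α β L M ε I)) := by
  have hα0 : 0 ≤ α := by linarith
  obtain ⟨u, v, huv, hsub⟩ := exists_Icc_subset_interior hI₀n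
  have hsubI : Icc u v ⊆ interior I := hsub.trans (interior_mono hI₀I)
  have huvI₀ : Icc u v ⊆ I₀ := hsub.trans interior_subset
  have huvI : Icc u v ⊆ I := huvI₀.trans hI₀I
  -- One derivative beyond the Hölder order of `α` also covers that of `β`.
  set K := holderOrder α + 1 with hK
  have hβK : holderOrder β + 1 ≤ K := Nat.succ_le_succ (holderOrder_mono hβα.le)
  obtain ⟨κ, φ, hφ⟩ := exists_isBaseline hI hL hM hMI u v K
  obtain ⟨C, hC0, hC⟩ := exists_bound_iteratedDeriv contDiff_oddBump hasCompactSupport_oddBump K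
  have hκ := hφ.pos
  have hκM := hφ.lt
  obtain ⟨A₀, hA₀, hA₀1, hA₀κ, hA₀M, hA₀C⟩ : ∃ A₀ : ℝ, 0 < A₀ ∧ A₀ ≤ 1 ∧ 8 * A₀ ≤ κ ∧
      A₀ ≤ M - κ ∧ 2 * (A₀ * C) ≤ L / 2 := by
    refine ⟨min 1 (min (κ / 8) (min (M - κ) (L / (4 * C)))), ?_, min_le_left _ _, ?_, ?_, ?_⟩
    · have : 0 < M - κ := by linarith
      positivity
    · have : min 1 (min (κ / 8) (min (M - κ) (L / (4 * C)))) ≤ κ / 8 :=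
        (min_le_right _ _).trans (min_le_left _ _)
      linarith
    · exact (min_le_right _ _).trans ((min_le_right _ _).trans (min_le_left _ _))
    · have : min 1 (min (κ / 8) (min (M - κ) (L / (4 * C)))) ≤ L / (4 * C) :=
        (min_le_right _ _).trans ((min_le_right _ _).trans (min_le_right _ _))
      rw [le_div_iff₀ (by positivity)] at this
      linarith
  -- Already at `n = 1` the scale is at most 1 and one wave fits into `[u, v]`.
  obtain ⟨h₀, h0, h01, h0uv⟩ : ∃ h₀ : ℝ, 0 < h₀ ∧ h₀ ≤ 1 ∧ 2 * h₀ ≤ v - u := by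
    have : 0 < (v - u) / 2 := by linarith
    refine ⟨min 1 ((v - u) / 2), by positivity, min_le_left _ _, ?_⟩
    linarith [min_le_right 1 ((v - u) / 2)]
  set c₁ := (A₀ / 4) ^ p / (8 * 2 ^ p) * h₀ ^ (p * β + 1) with hc₁
  set c₂ := (A₀ / 4) ^ p / (8 * 2 ^ p) * ((v - u) / 4 * h₀ ^ (p * α)) with hc₂
  have hc₁0 : 0 < c₁ := by positivity
  have hc₂0 : 0 < c₂ := by
    have : 0 < v - u := by linarith
    positivity
  -- the facts on the scale `h₀ n ^ (-1 / (2 a + 1))`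
  have hscale : ∀ a : ℝ, 0 ≤ a → ∀ n : ℕ, 1 ≤ n → ∀ h, h = h₀ * (n : ℝ) ^ (-(1 / (2 * a + 1))) →
      0 < h ∧ h ≤ 1 ∧ 2 * h ≤ v - u ∧ h ≤ (n : ℝ) ^ (-(1 / (2 * a + 1))) ∧ A₀ * h ^ a ≤ A₀ := by
    intro a ha n hn h hh
    have hn' : (1 : ℝ) ≤ n := by exact_mod_cast hn
    have hr0 : 0 < (n : ℝ) ^ (-(1 / (2 * a + 1))) := by positivity
    have hr1 : (n : ℝ) ^ (-(1 / (2 * a + 1))) ≤ 1 :=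
      Real.rpow_le_one_of_one_le_of_nonpos hn' (by rw [neg_nonpos]; positivity)
    have hpos : 0 < h := by rw [hh]; positivity
    have hle : h ≤ h₀ := by rw [hh]; exact mul_le_of_le_one_right h0.le hr1
    refine ⟨hpos, hle.trans h01, by linarith, by rw [hh]; exact mul_le_of_le_one_left hr0.le h01, ?_⟩
    exact mul_le_of_le_one_right hA₀.le (Real.rpow_le_one hpos.le (hle.trans h01) ha)
  have hcomb : ∀ (n : ℕ) (H : Set (ℝ → ℝ)),
      ENNReal.ofReal (c₁ * (n : ℝ) ^ (-((p * β + 1) / (2 * β + 1)))) ≤ minimaxRisk p I₀ n H →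
      ENNReal.ofReal (c₂ * (n : ℝ) ^ (-(p * α / (2 * α + 1)))) ≤ minimaxRisk p I₀ n H →
      ENNReal.ofReal (min c₁ c₂ * lowerRate p α β n) ≤ minimaxRisk p I₀ n H := by
    intro n H h1 h2
    rcases max_choice ((n : ℝ) ^ (-((p * β + 1) / (2 * β + 1)))) ((n : ℝ) ^ (-(p * α / (2 * α + 1))))
      with h | h
    · refine le_trans (ENNReal.ofReal_le_ofReal ?_) h1
      rw [lowerRate, h]
      exact mul_le_mul_of_nonneg_right (min_le_left _ _) (by positivity)
    · refine le_trans (ENNReal.ofReal_le_ofReal ?_) h2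
      rw [lowerRate, h]
      exact mul_le_mul_of_nonneg_right (min_le_right _ _) (by positivity)
  -- These densities have order `α` on all of `I`, so `m` and `ε` are arbitrary and any break points
  -- will do. Order `β` follows from `h ^ α ≤ h ^ β`.
  have hsmooth : ∀ (m : ℕ) (ε : ℝ) (n : ℕ), 1 ≤ n →
      ENNReal.ofReal (c₂ * (n : ℝ) ^ (-(p * α / (2 * α + 1)))) ≤
        minimaxRisk p I₀ n (densityClassOfCard m α β L M ε I) := by
    intro m ε n hn
    obtain ⟨h, hh⟩ : ∃ h, h = h₀ * (n : ℝ) ^ (-(1 / (2 * α + 1))) := ⟨_, rfl⟩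
    obtain ⟨hpos, hh1, hhuv, -, hA⟩ := hscale α hα0 n hn h hh
    obtain ⟨N, hN, hN'⟩ := exists_packing_number hpos hhuv
    have ht := isPacked_equispaced (u := u) (v := v) hpos hN
    have hA0 : 0 ≤ A₀ * h ^ α := by positivity
    have hAβ : A₀ * h ^ α ≤ A₀ * h ^ β := by
      have := Real.rpow_le_rpow_of_exponent_ge hpos hh1 hβα.le
      gcongr
    refine smooth_rate_le_minimaxRisk hφ hI huvI huvI₀ hp hA₀.le hA₀1 hA₀κ hα0 h0 h01 hn hh hh1 hN'
      ht fun S => ?_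
    have hcls : ∀ a, 0 ≤ a → holderOrder a + 1 ≤ K → A₀ * h ^ α ≤ A₀ * h ^ a →
        ∀ J : Set ℝ, J.OrdConnected → J ⊆ I → IsHolder a L M J
          (perturbed I φ (A₀ * h ^ α) h (fun k : Fin N => u + h + k * (2 * h)) S) :=
      fun a ha haK hAa J hJ hJI => isHolder_perturbed hφ hL ht hA0 (by linarith) (by linarith) ha haK
        hAa hC hA₀C hJ hJI
    obtain ⟨x, hx, hxI, -⟩ := exists_strictMono_mem_of_isOpen isOpen_interior
      (hsubI (left_mem_Icc.2 huv.le)) m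
    exact ⟨isDensityOn_perturbed hφ hI huvI ht hA0 (by linarith),
      hcls β hβ hβK hAβ I hI subset_rfl, x, hx, hxI, fun i =>
        hcls α hα0 le_rfl le_rfl _ (ordConnected_piece hI ε x i) (sep_subset _ _)⟩
  -- The only requirement on the break points is that their `ε`-neighbourhoods cover the wave
  -- centred at `u + h`; on the pieces just the baseline remains.
  have hrough : ∀ (n : ℕ), 1 ≤ n → ∀ (m : ℕ) (ε : ℝ) (x : Fin m → ℝ), StrictMono x →
      (∀ j, x j ∈ interior I) →
      (∀ h, h = h₀ * (n : ℝ) ^ (-(1 / (2 * β + 1))) → ∀ y, |y - (u + h)| < h →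
        ∃ j, |y - x j| < ε) →
      ENNReal.ofReal (c₁ * (n : ℝ) ^ (-((p * β + 1) / (2 * β + 1)))) ≤
        minimaxRisk p I₀ n (densityClassOfCard m α β L M ε I) := by
    intro n hn m ε x hx hxI hcov
    obtain ⟨h, hh⟩ : ∃ h, h = h₀ * (n : ℝ) ^ (-(1 / (2 * β + 1))) := ⟨_, rfl⟩
    obtain ⟨hpos, hh1, hhuv, -, hA⟩ := hscale β hβ n hn h hh
    have ht := isPacked_equispaced (u := u) (v := v) (N := 1) hpos (by simpa using hhuv)
    have hA0 : 0 ≤ A₀ * h ^ β := by positivity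
    refine rough_rate_le_minimaxRisk hφ hI huvI huvI₀ hp hA₀.le hA₀1 hA₀κ hβ h0 h01 hn hh hh1
      ht fun S => ?_
    refine ⟨isDensityOn_perturbed hφ hI huvI ht hA0 (by linarith),
      isHolder_perturbed hφ hL ht hA0 (by linarith) (by linarith) hβ hβK le_rfl hC hA₀C hI subset_rfl,
      x, hx, hxI, fun i => isHolder_perturbed_of_waves_eq_zero hφ hL le_rfl
        (ordConnected_piece hI ε x i) (sep_subset _ _) fun y hy => waves_eq_zero hpos fun k => ?_⟩
    by_contra! hlt
    have hk : ((k : ℕ) : ℝ) = 0 := by simp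
    rw [hk, zero_mul, add_zero] at hlt
    obtain ⟨j, hj⟩ := hcov h hh y hlt
    exact absurd hj (not_lt.2 (le_abs_sub_of_mem_piece hy j))
  refine ⟨min c₁ c₂, lt_min hc₁0 hc₂0, fun ε hε n hn => ⟨?_, fun hnε m hm => ?_⟩⟩
  -- The number of break points depends on `ε`, but neither rate constant depends on that number.
  · obtain ⟨m, x, hx, hxuv, hcov⟩ := exists_strictMono_fine huv hε
    refine (hcomb n _ ?_ (hsmooth m ε n hn)).trans
      (minimaxRisk_mono p I₀ n (densityClassOfCard_subset m α β L M ε I))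
    refine hrough n hn m ε x hx (fun j => hsubI (hxuv j)) fun h hh y hy => hcov y ?_
    obtain ⟨-, -, hhuv, -⟩ := hscale β hβ n hn h hh
    rw [abs_lt] at hy
    constructor <;> linarith
  · refine hcomb n _ ?_ (hsmooth m ε n hn)
    obtain ⟨h, hh⟩ : ∃ h, h = h₀ * (n : ℝ) ^ (-(1 / (2 * β + 1))) := ⟨_, rfl⟩
    obtain ⟨hpos, -, hhuv, hhn, -⟩ := hscale β hβ n hn h hh
    -- A break point at the centre `u + h` covers the whole wave, because `h ≤ n ^ (-1/(2β+1)) ≤ ε`.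
    obtain ⟨x, hx, hxI, hxc⟩ := exists_strictMono_mem_of_isOpen isOpen_interior
      (hsubI ⟨by linarith, by linarith⟩ : u + h ∈ interior I) m
    obtain ⟨j, hj⟩ := hxc hm
    refine hrough n hn m ε x hx hxI fun h' hh' y hy => ⟨j, ?_⟩
    rw [hj, hh, ← hh']
    exact hy.trans_le ((hh'.trans hh.symm).le.trans (hhn.trans hnε))
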